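/- Let $A\in\mathbb{R}^{n\times n}$, $B\in\mathbb{R}^{n\times m}$ and let the pair $\{A,B\}$ be controllable, i.e. $\operatorname{rank}[B,AB,\dots,A^{n-1}B]=n$. Let $\tilde n\ge 1$ be the least integer with $\operatorname{rank}[B,AB,\dots,A^{\tilde n-1}B]=n$. A real square matrix is called anti-Hurwitz if all its eigenvalues have positive real part; $P\succ0$ means that $P$ is symmetric positive definite. 1) The linear algebraic equations $$AG_0-G_0A+BY_0=A,\qquad G_0B=0$$ have a solution $Y_0\in\mathbb{R}^{m\times n}$, $G_0\in\mathbb{R}^{n\times n}$. Every solution has the following properties: the matrix $G_{\mathbf d}(\mu)=I_n+\mu G_0$ is anti-Hurwitz for all real $\mu\le 1/\tilde n$; the matrix $G_0-I_n$ is invertible; and, for all $\mu\in\mathbb{R}$, the matrix $A_0=A+BY_0(G_0-I_n)^{-1}$ satisfies $$A_0G_{\mathbf d}(\mu)=(G_{\mathbf d}(\mu)+\mu I_n)A_0,\qquad G_{\mathbf d}(\mu)B=B.$$ 2) For every such solution $(Y_0,G_0)$ and every $\mu\le 1/\tilde n$, with $G_{\mathbf d}=G_{\mathbf d}(\mu)$,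 the system $$A_0X+XA_0^\top+BY+Y^\top B^\top+G_{\mathbf d}X+XG_{\mathbf d}^\top=0,\quad G_{\mathbf d}X+XG_{\mathbf d}^\top\succ0,\quad X=X^\top\succ0$$ has a solution $X\in\mathbb{R}^{n\times n}$, $Y\in\mathbb{R}^{m\times n}$. 3) Let $(Y_0,G_0)$ be any solution of the equations in 1), let $\mu=-1$, i.e. $G_{\mathbf d}=I_n-G_0$, let $(X,Y)$ be any solution of the system in 2) with this $G_{\mathbf d}$, and let $T>0$. Put $$K_0=Y_0(G_0-I_n)^{-1},\quad K=YX^{-1},\quad \mathbf d(s)=e^{sG_{\mathbf d}},\quad \|x\|=\sqrt{x^\top\mathbf d(-\ln T)^\top X^{-1}\mathbf d(-\ln T)x}.$$ Then $\mathbf d$ is a dilation that is monotone with respect to $\|\cdot\|$, i.e. for each $x\ne0$ the function $s\mapsto\|\mathbf d(s)x\|$ is strictly increasing, tends to $+\infty$ as $s\to+\infty$ and to $0$ as $s\to-\infty$. Consequently the canonical homogeneous norm $\|0\|_{\mathbf d}=0$, $\|x\|_{\mathbf d}=e^{s_x}$ with $\|\mathbf d(-s_x)x\|=1$ for $x\neq0$,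 is well defined ($s_x$ exists and is unique). Consider the closed-loop system $$\dot x(t)=Ax(t)+Bu(x(t),x_0),\quad t>0,\qquad x(0)=x_0\in\mathbb{R}^n,$$ with the initial-state-dependent feedback $$u(x,x_0)=K_0x+K\,\mathbf d(-\ln T)\,\mathbf d\!\left(-\ln\left\|\tfrac{x}{\|x_0\|}\right\|_{\mathbf d}\right)x\ \text{ for }x_0\ne0,\qquad u(x,0)=K_0x,$$ whose solutions are understood in the sense of Filippov, for fixed $x_0$: locally absolutely continuous functions $x$ with $x(0)=x_0$ and, for almost every $t$, $\dot x(t)\in\bigcap_{\delta>0}\bigcap_{|S|=0}\overline{\mathrm{co}}\,f(B(x(t),\delta)\setminus S,\,x_0)$, where $f(x,x_0)=Ax+Bu(x,x_0)$, $B(y,\delta)$ is the ball of radius $\delta$ around $y$, and $|S|$ is Lebesgue measure. This system is fixed-time stable with the constant settling time $T$. That is: - it is Lyapunov stable: there is a continuous strictly increasing $\alpha:[0,\infty)\to[0,\infty)$ with $\alpha(0)=0$ such that $\|x(t)\|\le\alpha(\|x_0\|)$ for all $t\ge0$, all $x_0\in\mathbb{R}^n$ and all solutions $x$ on $[0,\infty)$;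 - it has a nonnegative, locally bounded and uniformly bounded settling-time function $\tilde T:\mathbb{R}^n\to[0,\infty)$ (for every $x_0\ne0$ all solutions on $[0,\infty)$ vanish for $t\ge\tilde T(x_0)$, and some solution on $[0,\infty)$ is nonzero on $[0,\tilde T(x_0))$), and $\tilde T(x_0)=T$ for all $x_0\neq0$; - for every $x_0\in\mathbb{R}^n$, every solution $x$ on $[0,\infty)$ satisfies $x(t)=0$ for all $t\ge T$, and, if $x_0\ne0$, $x(t)\neq0$ for all $t\in[0,T)$. 4) All solutions of the closed-loop system are unique: for every $x_0\in\mathbb{R}^n$ a solution on $[0,\infty)$ exists, and for every $b>0$ any two solutions on $[0,b]$ with the same initial state $x_0$ coincide on $[0,b]$. -/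

import Mathlib

open scoped Matrix

noncomputable section

namespace HomStab

/-! ### Controllable pairs -/

/-- The `n × (k m)` block matrix `[B, AB, …, A^(k-1) B]`; column `(j, l)` is column `l` of
`A^j B`. -/
def kalmanMatrix {n m : ℕ} (A : Matrix (Fin n) (Fin n) ℝ) (B : Matrix (Fin n) (Fin m) ℝ) (k : ℕ) :
    Matrix (Fin n) (Fin k × Fin m) ℝ :=
  Matrix.of fun i p => (A ^ (p.1 : ℕ) * B) i p.2

/-- The pair `{A, B}` is controllable: `rank [B, AB, …, A^(n-1) B] = n`. -/
def IsControllablePair {n m : ℕ} (A : Matrix (Fin n) (Fin n) ℝ) (B : Matrix (Fin n) (Fin m) ℝ) :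
    Prop :=
  (kalmanMatrix A B n).rank = n

/-- The least positive integer `k` such that `rank [B, AB, …, A^(k-1) B] = n`
(it exists for a controllable pair). -/
def controllabilityIndex {n m : ℕ} (A : Matrix (Fin n) (Fin n) ℝ)
    (B : Matrix (Fin n) (Fin m) ℝ) : ℕ :=
  sInf {k : ℕ | 1 ≤ k ∧ (kalmanMatrix A B k).rank = n}

/-- All complex eigenvalues of the real matrix `M` have positive real part. -/
def IsAntiHurwitz {n : ℕ} (M : Matrix (Fin n) (Fin n) ℝ) : Prop :=
  ∀ z ∈ spectrum ℂ (M.map (algebraMap ℝ ℂ)), 0 < z.re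

/-! ### The algebraic systems -/

/-- `A G₀ - G₀ A + B Y₀ = A` and `G₀ B = 0`. -/
def SolvesGeneratorEq {n m : ℕ} (A : Matrix (Fin n) (Fin n) ℝ) (B : Matrix (Fin n) (Fin m) ℝ)
    (Y₀ : Matrix (Fin m) (Fin n) ℝ) (G₀ : Matrix (Fin n) (Fin n) ℝ) : Prop :=
  A * G₀ - G₀ * A + B * Y₀ = A ∧ G₀ * B = 0

/-- The generator `G_d = I + μ G₀`. -/
def dilationGenerator {n : ℕ} (G₀ : Matrix (Fin n) (Fin n) ℝ) (μ : ℝ) :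
    Matrix (Fin n) (Fin n) ℝ :=
  1 + μ • G₀

/-- The gain `K₀ = Y₀ (G₀ - I)⁻¹`. -/
def linearGain {n m : ℕ} (Y₀ : Matrix (Fin m) (Fin n) ℝ) (G₀ : Matrix (Fin n) (Fin n) ℝ) :
    Matrix (Fin m) (Fin n) ℝ :=
  Y₀ * (G₀ - 1)⁻¹

/-- The matrix `A₀ = A + B Y₀ (G₀ - I)⁻¹`. -/
def shiftedMatrix {n m : ℕ} (A : Matrix (Fin n) (Fin n) ℝ) (B : Matrix (Fin n) (Fin m) ℝ)
    (Y₀ : Matrix (Fin m) (Fin n) ℝ) (G₀ : Matrix (Fin n) (Fin n) ℝ) :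
    Matrix (Fin n) (Fin n) ℝ :=
  A + B * linearGain Y₀ G₀

/-- The system of linear matrix equations and inequalities
`A₀ X + X A₀ᵀ + B Y + Yᵀ Bᵀ + G X + X Gᵀ = 0`, `G X + X Gᵀ ≻ 0`, `X = Xᵀ ≻ 0`
(`Matrix.PosDef` includes symmetry). -/
def SolvesLMI {n m : ℕ} (A₀ : Matrix (Fin n) (Fin n) ℝ) (B : Matrix (Fin n) (Fin m) ℝ)
    (G : Matrix (Fin n) (Fin n) ℝ) (X : Matrix (Fin n) (Fin n) ℝ)
    (Y : Matrix (Fin m) (Fin n) ℝ) : Prop :=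
  A₀ * X + X * A₀ᵀ + B * Y + Yᵀ * Bᵀ + G * X + X * Gᵀ = 0 ∧
    (G * X + X * Gᵀ).PosDef ∧ X.PosDef

/-! ### Dilations and the canonical homogeneous norm -/

/-- The linear group `d(s) = exp (s G)`. -/
def dil {n : ℕ} (G : Matrix (Fin n) (Fin n) ℝ) (s : ℝ) : Matrix (Fin n) (Fin n) ℝ :=
  NormedSpace.exp (s • G)

/-- The group `d(s) = exp (s G)` is a dilation which is monotone with respect to the norm `N`. -/
def IsMonotoneDilation {n : ℕ} (N : (Fin n → ℝ) → ℝ) (G : Matrix (Fin n) (Fin n) ℝ) : Prop :=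
  ∀ x : Fin n → ℝ, x ≠ 0 →
    Filter.Tendsto (fun s : ℝ => N (dil G s *ᵥ x)) Filter.atTop Filter.atTop ∧
    Filter.Tendsto (fun s : ℝ => N (dil G s *ᵥ x)) Filter.atBot (nhds 0) ∧
    StrictMono fun s : ℝ => N (dil G s *ᵥ x)

open Classical in
/-- The canonical homogeneous norm induced by the norm `N` and the dilation generated by `G`:
`‖0‖_d = 0`, and `‖x‖_d = exp s` with `N (d(-s) x) = 1` for `x ≠ 0`. The number `s` exists and is
unique when the dilation is monotone with respect to `N`; otherwise some such `s` is chosen. -/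
def homNorm {n : ℕ} (N : (Fin n → ℝ) → ℝ) (G : Matrix (Fin n) (Fin n) ℝ) (x : Fin n → ℝ) : ℝ :=
  if x = 0 then 0 else Real.exp (Classical.epsilon fun s : ℝ => N (dil G (-s) *ᵥ x) = 1)

/-- The weighted Euclidean norm `‖x‖ = √(xᵀ d(-ln T)ᵀ X⁻¹ d(-ln T) x)`. -/
def weightedNorm {n : ℕ} (X G : Matrix (Fin n) (Fin n) ℝ) (T : ℝ) (x : Fin n → ℝ) : ℝ :=
  Real.sqrt ((dil G (-Real.log T) *ᵥ x) ⬝ᵥ (X⁻¹ *ᵥ (dil G (-Real.log T) *ᵥ x)))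

/-! ### The feedback and the closed loop -/

open Classical in
/-- The feedback `u(x, x₀) = K₀ x + K d(-ln T) d(-ln ‖x/‖x₀‖‖_d) x` for `x₀ ≠ 0`, and
`u(x, 0) = K₀ x`; here `‖·‖` is `N` and `‖·‖_d` is induced by `N`. -/
def feedback {n m : ℕ} (N : (Fin n → ℝ) → ℝ) (G : Matrix (Fin n) (Fin n) ℝ)
    (K₀ K : Matrix (Fin m) (Fin n) ℝ) (T : ℝ) (x x₀ : Fin n → ℝ) : Fin m → ℝ :=
  if x₀ = 0 then K₀ *ᵥ x
  else K₀ *ᵥ x +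
    K *ᵥ (dil G (-Real.log T) *ᵥ (dil G (-Real.log (homNorm N G ((N x₀)⁻¹ • x))) *ᵥ x))

/-- The right-hand side `(x, x₀) ↦ A x + B u(x, x₀)` of the closed-loop system. -/
def closedLoop {n m : ℕ} (A : Matrix (Fin n) (Fin n) ℝ) (B : Matrix (Fin n) (Fin m) ℝ)
    (u : (Fin n → ℝ) → (Fin n → ℝ) → (Fin m → ℝ)) (x x₀ : Fin n → ℝ) : Fin n → ℝ :=
  A *ᵥ x + B *ᵥ u x x₀

/-! ### Filippov solutions -/

/-- Filippov's regularization of a vector field `g`: the intersection, over all `δ > 0` and all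
Lebesgue-null sets `S`, of the closed convex hulls of `g (ball x δ \ S)`. -/
def filippovMap {n : ℕ} (g : (Fin n → ℝ) → (Fin n → ℝ)) (x : Fin n → ℝ) : Set (Fin n → ℝ) :=
  {v | ∀ δ > 0, ∀ S : Set (Fin n → ℝ), MeasureTheory.volume S = 0 →
    v ∈ closure (convexHull ℝ (g '' (Metric.ball x δ \ S)))}

/-- `x` is a Filippov solution on `[0, b]` of `ẋ(t) = f(x(t), x(0))`, `x(0) = x₀`: it is absolutely
continuous on `[0, b]`, and `ẋ(t)` lies in the Filippov regularization of `f(·, x₀)` at `x(t)` for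
almost every `t ∈ (0, b)`. -/
def IsFilippovSolutionOn {n : ℕ} (f : (Fin n → ℝ) → (Fin n → ℝ) → (Fin n → ℝ)) (x₀ : Fin n → ℝ)
    (b : ℝ) (x : ℝ → (Fin n → ℝ)) : Prop :=
  x 0 = x₀ ∧ AbsolutelyContinuousOnInterval x 0 b ∧
    ∀ᵐ t : ℝ, t ∈ Set.Ioo 0 b → ∃ v ∈ filippovMap (fun y => f y x₀) (x t), HasDerivAt x v t

/-- `x` is a Filippov solution on `[0, ∞)`. -/
def IsFilippovSolution {n : ℕ} (f : (Fin n → ℝ) → (Fin n → ℝ) → (Fin n → ℝ)) (x₀ : Fin n → ℝ)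
    (x : ℝ → (Fin n → ℝ)) : Prop :=
  ∀ b > 0, IsFilippovSolutionOn f x₀ b x

/-! ### Stability notions for `ẋ(t) = f(x(t), x(0))` -/

/-- Functions of class `𝒦` on `[0, ∞)`. -/
def IsClassK (α : ℝ → ℝ) : Prop :=
  ContinuousOn α (Set.Ici 0) ∧ StrictMonoOn α (Set.Ici 0) ∧ α 0 = 0

/-- (Global uniform) Lyapunov stability with respect to the norm `N`. -/
def IsLyapunovStable {n : ℕ} (N : (Fin n → ℝ) → ℝ)
    (f : (Fin n → ℝ) → (Fin n → ℝ) → (Fin n → ℝ)) : Prop :=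
  ∃ α : ℝ → ℝ, IsClassK α ∧ ∀ x₀ x, IsFilippovSolution f x₀ x → ∀ t ≥ 0, N (x t) ≤ α (N x₀)

/-- `τ` is a settling-time function: it is nonnegative and locally bounded, and for every `x₀ ≠ 0`
every solution vanishes for `t ≥ τ x₀`, while at least one solution does not vanish on
`[0, τ x₀)`. -/
def IsSettlingTime {n : ℕ} (f : (Fin n → ℝ) → (Fin n → ℝ) → (Fin n → ℝ))
    (τ : (Fin n → ℝ) → ℝ) : Prop :=
  (∀ x₀, 0 ≤ τ x₀) ∧ (∀ S : Set (Fin n → ℝ), IsCompact S → BddAbove (τ '' S)) ∧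
    ∀ x₀, x₀ ≠ 0 →
      (∀ x, IsFilippovSolution f x₀ x → ∀ t ≥ τ x₀, x t = 0) ∧
      ∃ x, IsFilippovSolution f x₀ x ∧ ∀ t ∈ Set.Ico 0 (τ x₀), x t ≠ 0

/-- Fixed-time stability (Lyapunov stability and a uniformly bounded settling-time function) with
constant settling time: the settling-time function equals `T` at all nonzero initial states. -/
def IsFixedTimeStableWithConstant {n : ℕ} (N : (Fin n → ℝ) → ℝ)
    (f : (Fin n → ℝ) → (Fin n → ℝ) → (Fin n → ℝ)) (T : ℝ) : Prop :=
  IsLyapunovStable N f ∧ ∃ τ : (Fin n → ℝ) → ℝ, IsSettlingTime f τ ∧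
    (∃ Tmax > 0, ∀ x₀, τ x₀ ≤ Tmax) ∧ ∀ x₀, x₀ ≠ 0 → τ x₀ = T

end HomStab

end

/-!
Throughout, `A₀ = A + B K₀`, `C = B K`, `P = X⁻¹`, and `ñ` is the controllability index.

*Generator equations.* If `w G₀ = λ w` with `λ ≠ 0`, then `w B = 0` and `(w A) G₀ = (λ + 1) (w A)`.
By controllability the eigenvalues of `G₀` are therefore among `0, -1, …, -(ñ - 1)`
(`exists_eq_neg_natCast_of_vecMul`), which gives the anti-Hurwitz property and the invertibility of
`G₀ - 1`; the relation `A₀ (G₀ - 1) = G₀ A` gives `A₀ G₀ - G₀ A₀ = A₀`. Solvability is a duality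
argument: a functional obstructing it is a matrix `M` with `M B = 0` and `M A M = M² A`, for which
`M A` is nilpotent and so has trace zero (`trace_mul_eq_zero_of_commutator`).

*Matrix inequalities.* If they were infeasible, a pair of nonnegative forms would separate the
positive cone from the solutions of the matrix equation. The nonzero columns of `A₀ᵏ B` are
eigenvectors of `G` with positive eigenvalues, and induction on `k` shows that both forms
vanish on them, hence everywhere (`exists_solvesLMI`).

*Closed loop.* For `μ = -1` the field `x ↦ A₀ x` and the input matrix are homogeneous for the
dilation `d`, and the matrix equation says that `H = A₀ + C + G` is skew for the inner product of
`P`. Along a solution the homogeneous norm `r` of `x / ‖x₀‖` satisfies `ṙ = -1 / T`, so that the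
solutions away from the origin are explicit,
`x(t) = ‖x₀‖ d(ln T + ln r) exp (-ln r H) z` with `r = (a - t) / T` (`trajectory`). The homogeneous
norm is `C¹` away from the origin by the implicit function theorem, so the field is locally
Lipschitz there and Filippov solutions are classical and unique as long as they do not vanish
(`IsFilippovSolutionOn.hasDerivWithinAt`, `eqOn_Icc_of_locallyLipschitz`). A solution cannot leave
the origin, because the explicit trajectory through a nonzero state is nonzero at all earlier times
(`IsFilippovSolutionOn.eq_trajectory`). Staying at the origin is a Filippov solution as the
field is odd.
-/

namespace HomStab

/-! ### The generator equations -/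

section Algebra

variable {n m : ℕ}

lemma eq_zero_of_vecMul_eq_zero_of_rank {ι : Type*} [Fintype ι] {M : Matrix (Fin n) ι ℝ}
    (hM : M.rank = n) {w : Fin n → ℝ} (hw : w ᵥ* M = 0) : w = 0 := by
  have h := LinearMap.finrank_range_add_finrank_ker Mᵀ.mulVecLin
  rw [← Matrix.rank, Matrix.rank_transpose, hM, Module.finrank_fin_fun] at h
  have h0 : LinearMap.ker Mᵀ.mulVecLin = ⊥ := Submodule.finrank_eq_zero.mp (by omega)
  rw [LinearMap.ker_eq_bot'] at h0
  exact h0 w (by simpa [Matrix.mulVec_transpose] using hw)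

lemma eq_zero_of_vecMul_kalman {A : Matrix (Fin n) (Fin n) ℝ} {B : Matrix (Fin n) (Fin m) ℝ}
    {k : ℕ} (hk : (kalmanMatrix A B k).rank = n) {w : Fin n → ℝ}
    (hw : ∀ j < k, w ᵥ* (A ^ j * B) = 0) : w = 0 := by
  refine eq_zero_of_vecMul_eq_zero_of_rank hk ?_
  ext ⟨j, l⟩
  exact congrFun (hw j j.2) l

lemma IsControllablePair.index_spec {A : Matrix (Fin n) (Fin n) ℝ} {B : Matrix (Fin n) (Fin m) ℝ}
    (hAB : IsControllablePair A B) :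
    1 ≤ controllabilityIndex A B ∧ (kalmanMatrix A B (controllabilityIndex A B)).rank = n := by
  refine Nat.sInf_mem (s := {k : ℕ | 1 ≤ k ∧ (kalmanMatrix A B k).rank = n}) ?_
  rcases Nat.eq_zero_or_pos n with rfl | hn
  · exact ⟨1, le_rfl, Nat.le_zero.mp ((Matrix.rank_le_card_height _).trans (by simp))⟩
  · exact ⟨n, hn, hAB⟩

/-- A matrix `M` with `M B = 0` whose commutator with `A` factors through `B` satisfies
`M A M = M² A`. Hence `(M A)ᵏ = Mᵏ Aᵏ`, the powers of `M` kill the Kalman matrix one block at a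
time, and `M A` is nilpotent. -/
lemma trace_mul_eq_zero_of_commutator {A M : Matrix (Fin n) (Fin n) ℝ}
    {B : Matrix (Fin n) (Fin m) ℝ} {C : Matrix (Fin m) (Fin n) ℝ} (hAB : IsControllablePair A B)
    (hMB : M * B = 0) (hcomm : M * A - A * M + B * C = 0) : (M * A).trace = 0 := by
  have h1 : Commute M (M * A) := by
    have h := congrArg (M * ·) hcomm
    simp only [mul_add, mul_sub, mul_zero, ← Matrix.mul_assoc M B, hMB, Matrix.zero_mul,
      add_zero] at h
    rw [commute_iff_eq, mul_assoc]
    exact sub_eq_zero.mp h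
  have hpow : ∀ k : ℕ, (M * A) ^ k = M ^ k * A ^ k := by
    intro k
    induction k with
    | zero => simp
    | succ k ih =>
      calc (M * A) ^ (k + 1) = (M * A) * (M ^ k * A ^ k) := by rw [pow_succ', ih]
        _ = M ^ k * (M * A) * A ^ k := by rw [← mul_assoc, (h1.pow_left k).eq]
        _ = M ^ (k + 1) * A ^ (k + 1) := by rw [pow_succ M, pow_succ' A]; simp only [mul_assoc]
  have hkill : ∀ k : ℕ, M ^ (k + 1) * (A ^ k * B) = 0 := by
    intro k
    calc M ^ (k + 1) * (A ^ k * B) = M * (M ^ k * A ^ k) * B := by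
          rw [pow_succ']; simp only [Matrix.mul_assoc]
      _ = (M * A) ^ k * M * B := by rw [← hpow, (h1.pow_right k).eq]
      _ = 0 := by rw [Matrix.mul_assoc, hMB, Matrix.mul_zero]
  have hMn : M ^ n = 0 := by
    ext i j
    have : (M ^ n) i = 0 := by
      refine eq_zero_of_vecMul_kalman hAB fun j hj => ?_
      have h : M ^ n * (A ^ j * B) = 0 := by
        rw [← pow_sub_mul_pow M (Nat.succ_le_of_lt hj), Matrix.mul_assoc, hkill, Matrix.mul_zero]
      exact congrFun h i
    exact congrFun this j
  have hnil : IsNilpotent (M * A) := ⟨n, by rw [hpow, hMn, zero_mul]⟩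
  exact (Matrix.isNilpotent_trace_of_isNilpotent hnil).eq_zero

lemma exists_trace_eq {p q : ℕ} (φ : Matrix (Fin p) (Fin q) ℝ →ₗ[ℝ] ℝ) :
    ∃ M : Matrix (Fin q) (Fin p) ℝ, ∀ Z, φ Z = (M * Z).trace := by
  refine ⟨Matrix.of fun j i => φ (Matrix.single i j 1), fun Z => ?_⟩
  conv_lhs => rw [Matrix.matrix_eq_sum_single Z]
  simp only [map_sum, Matrix.trace, Matrix.diag, Matrix.mul_apply, Matrix.of_apply]
  rw [Finset.sum_comm]
  refine Finset.sum_congr rfl fun j _ => Finset.sum_congr rfl fun i _ => ?_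
  rw [show Matrix.single i j (Z i j) = Z i j • Matrix.single i j (1 : ℝ) by simp, map_smul,
    smul_eq_mul, mul_comm]

/-- The generator equations are solvable: a linear functional separating `(A, 0)` from the range
of `(Y, G) ↦ (A G - G A + B Y, G B)` would give matrices as in
`trace_mul_eq_zero_of_commutator`. -/
theorem exists_solvesGeneratorEq {A : Matrix (Fin n) (Fin n) ℝ} {B : Matrix (Fin n) (Fin m) ℝ}
    (hAB : IsControllablePair A B) : ∃ Y₀ G₀, SolvesGeneratorEq A B Y₀ G₀ := by
  let L : Matrix (Fin m) (Fin n) ℝ × Matrix (Fin n) (Fin n) ℝ →ₗ[ℝ]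
      Matrix (Fin n) (Fin n) ℝ × Matrix (Fin n) (Fin m) ℝ :=
    { toFun := fun p => (A * p.2 - p.2 * A + B * p.1, p.2 * B)
      map_add' := fun p q => by
        ext1 <;> simp only [Prod.fst_add, Prod.snd_add, mul_add, add_mul, Matrix.mul_add,
          Matrix.add_mul]
        abel
      map_smul' := fun c p => by
        ext1 <;> simp [smul_sub, smul_add] }
  by_contra hno
  have hmem : ((A, 0) : Matrix (Fin n) (Fin n) ℝ × Matrix (Fin n) (Fin m) ℝ) ∉
      LinearMap.range L := by
    rintro ⟨⟨Y₀, G₀⟩, h⟩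
    exact hno ⟨Y₀, G₀, congrArg Prod.fst h, congrArg Prod.snd h⟩
  obtain ⟨φ, hφ, hker⟩ := Submodule.exists_le_ker_of_notMem hmem
  obtain ⟨M, hM⟩ := exists_trace_eq (φ ∘ₗ LinearMap.inl ℝ _ _)
  obtain ⟨C, hC⟩ := exists_trace_eq (φ ∘ₗ LinearMap.inr ℝ _ _)
  have hsum : ∀ Z W, φ (Z, W) = (M * Z).trace + (C * W).trace := fun Z W => by
    rw [← hM, ← hC]
    simp [← map_add]
  have hzero : ∀ (Y : Matrix (Fin m) (Fin n) ℝ) (G : Matrix (Fin n) (Fin n) ℝ),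
      (M * (A * G - G * A + B * Y)).trace + (C * (G * B)).trace = 0 := by
    intro Y G
    rw [← hsum]
    exact hker ⟨(Y, G), rfl⟩
  apply hφ
  rw [hsum, Matrix.mul_zero, Matrix.trace_zero, add_zero]
  refine trace_mul_eq_zero_of_commutator (C := C) hAB ?_ ?_
  · refine Matrix.ext_iff_trace_mul_right.mpr fun Y => ?_
    have h : (M * (B * Y)).trace = 0 := by simpa using hzero Y 0
    rw [Matrix.mul_assoc, Matrix.zero_mul, Matrix.trace_zero]
    exact h
  · refine Matrix.ext_iff_trace_mul_right.mpr fun G => ?_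
    have h : (M * (A * G)).trace - (M * (G * A)).trace + (C * (G * B)).trace = 0 := by
      simpa [mul_sub] using hzero 0 G
    have h1 : (A * M * G).trace = (M * (G * A)).trace := by
      rw [Matrix.mul_assoc, Matrix.trace_mul_comm, Matrix.mul_assoc]
    have h2 : (B * C * G).trace = (C * (G * B)).trace := by
      rw [Matrix.mul_assoc, Matrix.trace_mul_comm, Matrix.mul_assoc]
    rw [add_mul, sub_mul, Matrix.trace_add, Matrix.trace_sub, h1, h2, Matrix.mul_assoc, zero_mul,
      Matrix.trace_zero]
    exact h

/-- If `w G₀ = λ w` for a row vector `w` and `λ ≠ 0`, then `w B = 0`, and `w A` is again a left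
eigenvector or zero, with `λ + 1` in place of `λ`. Iterating, `w` annihilates the Kalman matrix
with `k` blocks unless `λ` is one of `0, -1, …, -(k - 1)`. -/
lemma exists_eq_neg_natCast_of_vecMul {A : Matrix (Fin n) (Fin n) ℝ}
    {B : Matrix (Fin n) (Fin m) ℝ} {Y₀ : Matrix (Fin m) (Fin n) ℝ} {G₀ : Matrix (Fin n) (Fin n) ℝ}
    (hG : SolvesGeneratorEq A B Y₀ G₀) {k : ℕ} (hk : (kalmanMatrix A B k).rank = n)
    {w : Fin n → ℂ} (hw0 : w ≠ 0) {z : ℂ}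
    (hw : w ᵥ* G₀.map (algebraMap ℝ ℂ) = z • w) : ∃ j < k, z = -(j : ℂ) := by
  by_contra! hz
  apply hw0
  set c := algebraMap ℝ ℂ
  have hGB : G₀.map c * B.map c = 0 := by
    rw [← Matrix.map_mul, hG.2, Matrix.map_zero _ (map_zero c)]
  have hGA : G₀.map c * A.map c = A.map c * G₀.map c + B.map c * Y₀.map c - A.map c := by
    have : G₀ * A = A * G₀ + B * Y₀ - A := by
      have h := hG.1
      rw [sub_add_eq_add_sub, sub_eq_iff_eq_add] at h
      rw [h]; abel
    rw [← Matrix.map_mul, this, Matrix.map_sub _ (map_sub c), Matrix.map_add _ (map_add c),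
      Matrix.map_mul, Matrix.map_mul]
  have hB : ∀ (v : Fin n → ℂ) (y : ℂ), y ≠ 0 → v ᵥ* G₀.map c = y • v → v ᵥ* B.map c = 0 := by
    intro v y hy hv
    have h : y • (v ᵥ* B.map c) = 0 := by
      rw [← Matrix.smul_vecMul, ← hv, Matrix.vecMul_vecMul, hGB, Matrix.vecMul_zero]
    exact (smul_eq_zero.mp h).resolve_left hy
  have hA : ∀ j : ℕ, j ≤ k → (w ᵥ* A.map c ^ j) ᵥ* G₀.map c = (z + j) • (w ᵥ* A.map c ^ j) := by
    intro j
    induction j with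
    | zero => intro _; simpa using hw
    | succ j ih =>
      intro hj
      have ih := ih (by omega)
      have hBj := hB _ _ (fun h => hz j hj (eq_neg_of_add_eq_zero_left h)) ih
      rw [pow_succ, ← Matrix.vecMul_vecMul]
      set v := w ᵥ* A.map c ^ j
      have h2 : v ᵥ* (G₀.map c * A.map c) = (z + j) • (v ᵥ* A.map c) := by
        rw [← Matrix.vecMul_vecMul, ih, Matrix.smul_vecMul]
      rw [hGA, Matrix.vecMul_sub, Matrix.vecMul_add, ← Matrix.vecMul_vecMul, ← Matrix.vecMul_vecMul,
        hBj, Matrix.zero_vecMul, add_zero, sub_eq_iff_eq_add] at h2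
      rw [h2]
      push_cast
      module
  have hK : ∀ j < k, w ᵥ* (A ^ j * B).map c = 0 := by
    intro j hj
    have := hB _ _ (fun h => hz j hj (eq_neg_of_add_eq_zero_left h)) (hA j hj.le)
    rwa [Matrix.vecMul_vecMul, ← Matrix.map_pow, ← Matrix.map_mul] at this
  have hre : (fun i => (w i).re) = 0 := by
    refine eq_zero_of_vecMul_kalman hk fun j hj => ?_
    ext l
    have := congrArg Complex.re (congrFun (hK j hj) l)
    simpa [Matrix.vecMul, dotProduct, c] using this
  have him : (fun i => (w i).im) = 0 := by
    refine eq_zero_of_vecMul_kalman hk fun j hj => ?_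
    ext l
    have := congrArg Complex.im (congrFun (hK j hj) l)
    simpa [Matrix.vecMul, dotProduct, c] using this
  ext i
  exact Complex.ext (congrFun hre i) (congrFun him i)

lemma exists_vecMul_eq_smul_of_mem_spectrum {M : Matrix (Fin n) (Fin n) ℂ} {z : ℂ}
    (hz : z ∈ spectrum ℂ M) : ∃ w ≠ 0, w ᵥ* M = z • w := by
  rw [spectrum.mem_iff, Matrix.isUnit_iff_isUnit_det, isUnit_iff_ne_zero, not_not] at hz
  obtain ⟨w, hw0, hw⟩ := Matrix.exists_vecMul_eq_zero_iff.mpr hz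
  refine ⟨w, hw0, ?_⟩
  rw [Matrix.vecMul_sub, sub_eq_zero, Algebra.algebraMap_eq_smul_one, Matrix.vecMul_smul,
    Matrix.vecMul_one] at hw
  exact hw.symm

theorem SolvesGeneratorEq.isAntiHurwitz {A : Matrix (Fin n) (Fin n) ℝ}
    {B : Matrix (Fin n) (Fin m) ℝ} {Y₀ : Matrix (Fin m) (Fin n) ℝ} {G₀ : Matrix (Fin n) (Fin n) ℝ}
    (hG : SolvesGeneratorEq A B Y₀ G₀) (hAB : IsControllablePair A B) {μ : ℝ}
    (hμ : μ ≤ 1 / (controllabilityIndex A B : ℝ)) : IsAntiHurwitz (dilationGenerator G₀ μ) := by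
  obtain ⟨hk1, hk⟩ := hAB.index_spec
  intro z hz
  obtain ⟨w, hw0, hw⟩ := exists_vecMul_eq_smul_of_mem_spectrum hz
  have hmap : (dilationGenerator G₀ μ).map (algebraMap ℝ ℂ) =
      1 + (μ : ℂ) • G₀.map (algebraMap ℝ ℂ) := by
    ext i j
    simp [dilationGenerator, Matrix.one_apply, apply_ite]
  rw [hmap, Matrix.vecMul_add, Matrix.vecMul_one, Matrix.vecMul_smul] at hw
  by_cases hμ0 : μ = 0
  · subst hμ0
    have h : (z - 1) • w = 0 := by rw [sub_smul, one_smul, ← hw]; simp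
    have : z = 1 := sub_eq_zero.mp ((smul_eq_zero.mp h).resolve_right hw0)
    simp [this]
  · have hμc : (μ : ℂ) ≠ 0 := by exact_mod_cast hμ0
    have h : w ᵥ* G₀.map (algebraMap ℝ ℂ) = ((z - 1) / μ) • w := by
      have h' : (μ : ℂ) • (w ᵥ* G₀.map (algebraMap ℝ ℂ)) = (z - 1) • w := by
        rw [sub_smul, one_smul, ← hw]; abel
      rw [div_eq_inv_mul, mul_smul, ← h', smul_smul, inv_mul_cancel₀ hμc, one_smul]
    obtain ⟨j, hj, hzj⟩ := exists_eq_neg_natCast_of_vecMul hG hk hw0 h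
    have hz' : z = ((1 - μ * j : ℝ) : ℂ) := by
      rw [div_eq_iff hμc] at hzj
      push_cast
      linear_combination hzj
    rw [hz', Complex.ofReal_re]
    have hkpos : (0 : ℝ) < controllabilityIndex A B := by exact_mod_cast hk1
    have hjk : (j : ℝ) < controllabilityIndex A B := by exact_mod_cast hj
    rw [le_div_iff₀ hkpos] at hμ
    rcases le_or_gt μ 0 with h0 | h0
    · nlinarith [mul_nonneg (neg_nonneg.mpr h0) (Nat.cast_nonneg (α := ℝ) j)]
    · nlinarith [mul_lt_mul_of_pos_left hjk h0]

theorem SolvesGeneratorEq.isUnit_sub_one {A : Matrix (Fin n) (Fin n) ℝ}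
    {B : Matrix (Fin n) (Fin m) ℝ} {Y₀ : Matrix (Fin m) (Fin n) ℝ} {G₀ : Matrix (Fin n) (Fin n) ℝ}
    (hG : SolvesGeneratorEq A B Y₀ G₀) (hAB : IsControllablePair A B) : IsUnit (G₀ - 1) := by
  rw [Matrix.isUnit_iff_isUnit_det, isUnit_iff_ne_zero]
  intro h0
  obtain ⟨w, hw0, hw⟩ := Matrix.exists_vecMul_eq_zero_iff.mpr h0
  rw [Matrix.vecMul_sub, Matrix.vecMul_one, sub_eq_zero] at hw
  have hw' : (fun i => (w i : ℂ)) ᵥ* G₀.map (algebraMap ℝ ℂ) = (1 : ℂ) • fun i => (w i : ℂ) := by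
    ext i
    have := congrArg (algebraMap ℝ ℂ) (congrFun hw i)
    simpa [Matrix.vecMul, dotProduct] using this
  obtain ⟨j, -, hj⟩ := exists_eq_neg_natCast_of_vecMul hG hAB.index_spec.2
    (fun h => hw0 (funext fun i => by simpa using congrFun h i)) hw'
  have : (1 : ℝ) = -(j : ℝ) := by exact_mod_cast hj
  linarith [Nat.cast_nonneg (α := ℝ) j]

lemma SolvesGeneratorEq.shiftedMatrix_mul_sub_one {A : Matrix (Fin n) (Fin n) ℝ}
    {B : Matrix (Fin n) (Fin m) ℝ} {Y₀ : Matrix (Fin m) (Fin n) ℝ} {G₀ : Matrix (Fin n) (Fin n) ℝ}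
    (hG : SolvesGeneratorEq A B Y₀ G₀) (hAB : IsControllablePair A B) :
    shiftedMatrix A B Y₀ G₀ * (G₀ - 1) = G₀ * A := by
  have hdet := (Matrix.isUnit_iff_isUnit_det _).mp (hG.isUnit_sub_one hAB)
  rw [shiftedMatrix, linearGain, add_mul, Matrix.mul_assoc, Matrix.mul_assoc,
    Matrix.nonsing_inv_mul _ hdet, Matrix.mul_one, mul_sub, mul_one]
  rw [← sub_eq_zero, ← sub_eq_zero.mpr hG.1]
  abel

lemma SolvesGeneratorEq.shiftedMatrix_commutator {A : Matrix (Fin n) (Fin n) ℝ}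
    {B : Matrix (Fin n) (Fin m) ℝ} {Y₀ : Matrix (Fin m) (Fin n) ℝ} {G₀ : Matrix (Fin n) (Fin n) ℝ}
    (hG : SolvesGeneratorEq A B Y₀ G₀) (hAB : IsControllablePair A B) :
    shiftedMatrix A B Y₀ G₀ * G₀ = G₀ * shiftedMatrix A B Y₀ G₀ + shiftedMatrix A B Y₀ G₀ := by
  have h : G₀ * shiftedMatrix A B Y₀ G₀ = G₀ * A := by
    rw [shiftedMatrix, mul_add, ← Matrix.mul_assoc, hG.2, Matrix.zero_mul, add_zero]
  rw [h, ← hG.shiftedMatrix_mul_sub_one hAB]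
  noncomm_ring

theorem SolvesGeneratorEq.dilationGenerator_mul {A : Matrix (Fin n) (Fin n) ℝ}
    {B : Matrix (Fin n) (Fin m) ℝ} {Y₀ : Matrix (Fin m) (Fin n) ℝ} {G₀ : Matrix (Fin n) (Fin n) ℝ}
    (hG : SolvesGeneratorEq A B Y₀ G₀) (μ : ℝ) : dilationGenerator G₀ μ * B = B := by
  rw [dilationGenerator, Matrix.add_mul, Matrix.one_mul, Matrix.smul_mul, hG.2, smul_zero, add_zero]

theorem SolvesGeneratorEq.shiftedMatrix_mul_dilationGenerator {A : Matrix (Fin n) (Fin n) ℝ}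
    {B : Matrix (Fin n) (Fin m) ℝ} {Y₀ : Matrix (Fin m) (Fin n) ℝ} {G₀ : Matrix (Fin n) (Fin n) ℝ}
    (hG : SolvesGeneratorEq A B Y₀ G₀) (hAB : IsControllablePair A B) (μ : ℝ) :
    shiftedMatrix A B Y₀ G₀ * dilationGenerator G₀ μ =
      (dilationGenerator G₀ μ + μ • 1) * shiftedMatrix A B Y₀ G₀ := by
  simp only [dilationGenerator, mul_add, add_mul, Matrix.mul_smul, Matrix.smul_mul, mul_one,
    one_mul, hG.shiftedMatrix_commutator hAB, smul_add, add_assoc]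

/-- State feedback does not enlarge the common left kernel of the blocks `Aʲ B`. -/
lemma eq_zero_of_vecMul_feedback {A : Matrix (Fin n) (Fin n) ℝ} {B : Matrix (Fin n) (Fin m) ℝ}
    (hAB : IsControllablePair A B) (F : Matrix (Fin m) (Fin n) ℝ) {w : Fin n → ℝ}
    (hw : ∀ j, w ᵥ* ((A + B * F) ^ j * B) = 0) : w = 0 := by
  have h : ∀ j, w ᵥ* (A + B * F) ^ j = w ᵥ* A ^ j := by
    intro j
    induction j with
    | zero => simp
    | succ j ih =>
      have hj := hw j
      rw [← Matrix.vecMul_vecMul, ih] at hj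
      rw [pow_succ, ← Matrix.vecMul_vecMul, ih, Matrix.vecMul_add, ← Matrix.vecMul_vecMul _ B, hj,
        Matrix.zero_vecMul, add_zero, Matrix.vecMul_vecMul, pow_succ]
  refine eq_zero_of_vecMul_kalman hAB fun j _ => ?_
  rw [← Matrix.vecMul_vecMul, ← h, Matrix.vecMul_vecMul, hw]

lemma pow_mul_eigenvector {A₀ G₀ : Matrix (Fin n) (Fin n) ℝ} {B : Matrix (Fin n) (Fin m) ℝ}
    (hA : A₀ * G₀ = G₀ * A₀ + A₀) (hB : G₀ * B = 0) (μ : ℝ) (k : ℕ) :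
    dilationGenerator G₀ μ * (A₀ ^ k * B) = (1 - μ * k) • (A₀ ^ k * B) := by
  have h : G₀ * (A₀ ^ k * B) = -(k : ℝ) • (A₀ ^ k * B) := by
    induction k with
    | zero => simp [hB]
    | succ k ih =>
      have hGA : G₀ * A₀ = A₀ * G₀ - A₀ := by rw [hA]; abel
      rw [pow_succ', Matrix.mul_assoc, ← Matrix.mul_assoc G₀, hGA, Matrix.sub_mul,
        Matrix.mul_assoc, ih, Matrix.mul_smul]
      push_cast
      module
  rw [dilationGenerator, Matrix.add_mul, Matrix.one_mul, Matrix.smul_mul, h]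
  module

end Algebra

/-! ### The linear matrix inequalities -/

section LMI

open Matrix

variable {n m : ℕ}

/-- The symmetric matrix `u zᵀ + z uᵀ`. -/
def symProd (u z : Fin n → ℝ) : Matrix (Fin n) (Fin n) ℝ :=
  vecMulVec u z + vecMulVec z u

lemma symProd_comm (u z : Fin n → ℝ) : symProd u z = symProd z u := add_comm _ _

lemma symProd_add_left (u v z : Fin n → ℝ) : symProd (u + v) z = symProd u z + symProd v z := by
  simp only [symProd, add_vecMulVec, vecMulVec_add]; abel

lemma symProd_smul_left (c : ℝ) (u z : Fin n → ℝ) : symProd (c • u) z = c • symProd u z := by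
  simp only [symProd, smul_vecMulVec, vecMulVec_smul, smul_add]

lemma symProd_zero_left (z : Fin n → ℝ) : symProd 0 z = 0 := by simp [symProd]

lemma mul_symProd_add (M : Matrix (Fin n) (Fin n) ℝ) (u z : Fin n → ℝ) :
    M * symProd u z + symProd u z * Mᵀ = symProd (M *ᵥ u) z + symProd u (M *ᵥ z) := by
  simp only [symProd, mul_add, add_mul, mul_vecMulVec, vecMulVec_mul, vecMul_transpose]
  abel

lemma dotProduct_symProd_self (v z : Fin n → ℝ) :
    v ⬝ᵥ (symProd z z *ᵥ v) = 2 * (v ⬝ᵥ z) ^ 2 := by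
  simp only [symProd, add_mulVec, vecMulVec_mulVec, dotProduct_add, dotProduct_smul,
    op_smul_eq_smul, smul_eq_mul, dotProduct_comm z v]
  ring

lemma sum_symProd_single : ∑ i : Fin n, symProd (Pi.single i 1) (Pi.single i 1) =
    (2 : ℝ) • (1 : Matrix (Fin n) (Fin n) ℝ) := by
  ext a b
  simp only [symProd, Matrix.sum_apply, Matrix.add_apply, vecMulVec_apply, Matrix.smul_apply,
    Matrix.one_apply, Pi.single_apply]
  by_cases hab : a = b
  · subst hab; simp [← two_mul]
  · simp only [hab, if_false, smul_zero]
    refine Finset.sum_eq_zero fun i _ => ?_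
    by_cases ha : a = i
    · have : b ≠ i := fun h => hab (ha.trans h.symm)
      simp [this]
    · simp [ha]

lemma isOpen_setOf_forall_quadratic_pos :
    IsOpen {Z : Matrix (Fin n) (Fin n) ℝ | ∀ v : Fin n → ℝ, v ≠ 0 → 0 < v ⬝ᵥ (Z *ᵥ v)} := by
  -- by homogeneity it is enough to test the vectors of the compact unit sphere
  have heq : {Z : Matrix (Fin n) (Fin n) ℝ | ∀ v : Fin n → ℝ, v ≠ 0 → 0 < v ⬝ᵥ (Z *ᵥ v)} =
      {Z | ∀ v ∈ Metric.sphere (0 : Fin n → ℝ) 1, 0 < v ⬝ᵥ (Z *ᵥ v)} := by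
    ext Z
    refine ⟨fun h v hv => h v (by rintro rfl; simp at hv), fun h v hv => ?_⟩
    have h0 : 0 < ‖v‖ := norm_pos_iff.mpr hv
    have h1 := h (‖v‖⁻¹ • v) (by simp [norm_smul, h0.ne'])
    rw [mulVec_smul, dotProduct_smul, smul_dotProduct, smul_eq_mul, smul_eq_mul] at h1
    have h2 := mul_pos (mul_pos h0 h0) h1
    field_simp at h2
    exact h2
  rw [heq, isOpen_iff_mem_nhds]
  intro Z hZ
  refine (isCompact_sphere (0 : Fin n → ℝ) 1).eventually_forall_of_forall_eventually
    fun v hv => ?_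
  have hc : Continuous fun p : Matrix (Fin n) (Fin n) ℝ × (Fin n → ℝ) =>
      p.2 ⬝ᵥ (p.1 *ᵥ p.2) :=
    continuous_snd.dotProduct (continuous_fst.matrix_mulVec continuous_snd)
  exact hc.continuousAt.eventually (lt_mem_nhds (hZ v hv))

/-- A linear functional that is nonnegative on all `v vᵀ` satisfies a Cauchy–Schwarz inequality;
this is its equality case. -/
lemma map_symProd_eq_zero {φ : Matrix (Fin n) (Fin n) ℝ →ₗ[ℝ] ℝ}
    (hφ : ∀ v, 0 ≤ φ (symProd v v)) {u : Fin n → ℝ} (hu : φ (symProd u u) = 0) (z : Fin n → ℝ) :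
    φ (symProd u z) = 0 := by
  have h : ∀ t : ℝ, 0 ≤ φ (symProd z z) + t * (2 * φ (symProd u z)) := by
    intro t
    have h1 := hφ (z + t • u)
    rw [symProd_add_left, symProd_comm z, symProd_smul_left, symProd_comm u (z + _),
      symProd_add_left, symProd_smul_left, symProd_add_left, symProd_smul_left,
      symProd_comm z u] at h1
    simp only [map_add, map_smul, smul_eq_mul, hu] at h1
    linarith
  by_contra hne
  have h1 := h (-(φ (symProd z z) + 1) / (2 * φ (symProd u z)))
  rw [div_mul_cancel₀ _ (mul_ne_zero two_ne_zero hne)] at h1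
  linarith

/-- The linear matrix inequalities are feasible. If not, the open cone of pairs of matrices with
positive quadratic forms misses the subspace of pairs `(G X + X Gᵀ, X)` for which the matrix
equation holds with some `Y`. A separating functional is a pair of forms nonnegative on all
`v vᵀ`, and on that subspace it factors through the left-hand side of the equation. Testing
it on `u zᵀ + z uᵀ` with `u` in the range of `A₀ᵏ B` shows, by induction on `k`, that it vanishes
there; as these vectors span the space, the functional vanishes at the pair of identity
matrices. -/
theorem exists_solvesLMI {A₀ G : Matrix (Fin n) (Fin n) ℝ} {B : Matrix (Fin n) (Fin m) ℝ}
    {γ : ℕ → ℝ} (hG : ∀ k, G * (A₀ ^ k * B) = γ k • (A₀ ^ k * B))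
    (hγ : ∀ k, A₀ ^ k * B ≠ 0 → 0 < γ k)
    (hspan : ∀ w : Fin n → ℝ, (∀ k, w ᵥ* (A₀ ^ k * B) = 0) → w = 0) :
    ∃ X Y, SolvesLMI A₀ B G X Y := by
  let E := Matrix (Fin n) (Fin n) ℝ
  let lyap : E → E →ₗ[ℝ] E := fun M =>
    LinearMap.mulLeft ℝ M + LinearMap.mulRight ℝ Mᵀ
  let sym : E →ₗ[ℝ] E := LinearMap.id + (transposeLinearEquiv (Fin n) (Fin n) ℝ ℝ).toLinearMap
  let inp : Matrix (Fin m) (Fin n) ℝ →ₗ[ℝ] E :=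
    sym ∘ₗ mulLeftLinearMap (Fin n) ℝ B
  let S : E × Matrix (Fin m) (Fin n) ℝ →ₗ[ℝ] E := sym ∘ₗ LinearMap.fst ℝ _ _
  let τ : E × Matrix (Fin m) (Fin n) ℝ →ₗ[ℝ] E :=
    lyap A₀ ∘ₗ S + inp ∘ₗ LinearMap.snd ℝ _ _ + lyap G ∘ₗ S
  let σ : E × Matrix (Fin m) (Fin n) ℝ →ₗ[ℝ] E × E := (lyap G ∘ₗ S).prod S
  have hlyap : ∀ M Z : E, lyap M Z = M * Z + Z * Mᵀ := fun M Z => rfl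
  have hsym : ∀ Z : E, sym Z = Z + Zᵀ := fun Z => rfl
  have hinp : ∀ Y, inp Y = B * Y + Yᵀ * Bᵀ := fun Y => by
    change B * Y + (B * Y)ᵀ = _
    rw [transpose_mul]
  have hsymQ : ∀ u z : Fin n → ℝ, sym (vecMulVec u z) = symProd u z := fun u z => by
    rw [hsym, transpose_vecMulVec]; rfl
  let O : Set (E × E) := {p | (∀ v : Fin n → ℝ, v ≠ 0 → 0 < v ⬝ᵥ (p.1 *ᵥ v)) ∧
    ∀ v : Fin n → ℝ, v ≠ 0 → 0 < v ⬝ᵥ (p.2 *ᵥ v)}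
  by_cases hdisj : Disjoint O ((LinearMap.ker τ).map σ : Set (E × E))
  swap
  · obtain ⟨_, ⟨h1, h2⟩, ⟨⟨X, Y⟩, hτ, rfl⟩⟩ := Set.not_disjoint_iff.mp hdisj
    have hS : (sym X).IsHermitian := by
      rw [IsHermitian, conjTranspose_eq_transpose_of_trivial, hsym, transpose_add,
        transpose_transpose, add_comm]
    have hS' : (sym X)ᵀ = sym X := by
      rw [← conjTranspose_eq_transpose_of_trivial]; exact hS
    refine ⟨sym X, Y, ?_, PosDef.of_dotProduct_mulVec_pos ?_ fun v hv => ?_,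
      PosDef.of_dotProduct_mulVec_pos hS fun v hv => ?_⟩
    · have h : lyap A₀ (sym X) + inp Y + lyap G (sym X) = 0 := hτ
      rw [hlyap, hlyap, hinp] at h
      rw [← h]; abel
    · rw [IsHermitian, conjTranspose_eq_transpose_of_trivial, transpose_add, transpose_mul,
        transpose_mul, transpose_transpose, hS', add_comm]
    · rw [star_trivial]; exact h1 v hv
    · rw [star_trivial]; exact h2 v hv
  exfalso
  have hOopen : IsOpen O :=
    (isOpen_setOf_forall_quadratic_pos.preimage continuous_fst).inter
      (isOpen_setOf_forall_quadratic_pos.preimage continuous_snd)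
  have hOconv : Convex ℝ O := by
    have key : ∀ (Z W : E) (a b : ℝ), 0 ≤ a → 0 ≤ b → a + b = 1 → ∀ v : Fin n → ℝ,
        0 < v ⬝ᵥ (Z *ᵥ v) → 0 < v ⬝ᵥ (W *ᵥ v) → 0 < v ⬝ᵥ ((a • Z + b • W) *ᵥ v) := by
      intro Z W a b ha hb hab v hZ hW
      rw [add_mulVec, smul_mulVec, smul_mulVec, dotProduct_add, dotProduct_smul, dotProduct_smul]
      exact (convex_Ioi (0 : ℝ)) hZ hW ha hb hab
    intro p hp q hq a b ha hb hab
    exact ⟨fun v hv => key _ _ a b ha hb hab v (hp.1 v hv) (hq.1 v hv),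
      fun v hv => key _ _ a b ha hb hab v (hp.2 v hv) (hq.2 v hv)⟩
  obtain ⟨f, c, hfO, hfL⟩ := geometric_hahn_banach_open hOconv hOopen
    ((LinearMap.ker τ).map σ).convex hdisj
  have hc : c ≤ 0 := by simpa using hfL 0 (Submodule.zero_mem _)
  have hfL0 : ∀ p, τ p = 0 → f (σ p) = 0 := by
    intro p hp
    by_contra hne
    have h := hfL (((c - 1) / f (σ p)) • σ p)
      (Submodule.smul_mem _ _ (Submodule.mem_map_of_mem hp))
    rw [map_smul, smul_eq_mul, div_mul_cancel₀ _ hne] at h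
    linarith
  obtain ⟨g, hg⟩ : ∃ g : E →ₗ[ℝ] ℝ, ∀ p, g (τ p) = f (σ p) := by
    have : (f : E × E →ₗ[ℝ] ℝ) ∘ₗ σ ∈ (LinearMap.ker τ).dualAnnihilator :=
      (Submodule.mem_dualAnnihilator _).mpr fun p hp => hfL0 p hp
    rw [← LinearMap.range_dualMap_eq_dualAnnihilator_ker] at this
    obtain ⟨g, hg⟩ := this
    exact ⟨g, fun p => LinearMap.congr_fun hg p⟩
  let φ : E →ₗ[ℝ] ℝ := -((f : E × E →ₗ[ℝ] ℝ) ∘ₗ LinearMap.inl ℝ E E)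
  let ψ : E →ₗ[ℝ] ℝ := -((f : E × E →ₗ[ℝ] ℝ) ∘ₗ LinearMap.inr ℝ E E)
  have hf : ∀ Z X : E, f (Z, X) = -(φ Z + ψ X) := by
    intro Z X
    simp only [φ, ψ, LinearMap.neg_apply, LinearMap.comp_apply, ← neg_add, neg_neg,
      ContinuousLinearMap.coe_coe, ← map_add]
    simp
  have hone : ∀ (v : Fin n → ℝ), v ≠ 0 → 0 < v ⬝ᵥ ((1 : E) *ᵥ v) := fun v hv => by
    rw [one_mulVec]
    simpa using dotProduct_star_self_pos_iff.mpr hv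
  have hO1 : ((1, 1) : E × E) ∈ O := ⟨hone, hone⟩
  -- positive semidefinite pairs are limits of pairs in the open cone
  have hadd : ∀ (Z W : E), (∀ v : Fin n → ℝ, 0 ≤ v ⬝ᵥ (Z *ᵥ v)) →
      (∀ v : Fin n → ℝ, 0 ≤ v ⬝ᵥ (W *ᵥ v)) → 0 ≤ φ Z + ψ W := by
    intro Z W hZ hW
    have h1 : ∀ ε > 0, 0 ≤ (φ Z + ψ W) + ε * (φ 1 + ψ 1) := by
      intro ε hε
      have key : ∀ Z : E, (∀ v : Fin n → ℝ, 0 ≤ v ⬝ᵥ (Z *ᵥ v)) → ∀ v : Fin n → ℝ, v ≠ 0 →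
          0 < v ⬝ᵥ ((Z + ε • (1 : E)) *ᵥ v) := by
        intro Z hZ v hv
        rw [add_mulVec, smul_mulVec, dotProduct_add, dotProduct_smul]
        exact add_pos_of_nonneg_of_pos (hZ v) (mul_pos hε (hone v hv))
      have h := hfO (Z + ε • 1, W + ε • 1) ⟨key Z hZ, key W hW⟩
      rw [hf] at h
      simp only [map_add, map_smul, smul_eq_mul] at h
      linarith
    refine ge_of_tendsto (x := nhdsWithin (0 : ℝ) (Set.Ioi 0))
      (f := fun ε : ℝ => (φ Z + ψ W) + ε * (φ 1 + ψ 1)) ?_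
      (eventually_mem_nhdsWithin.mono fun ε hε => h1 ε hε)
    have : Continuous fun ε : ℝ => (φ Z + ψ W) + ε * (φ 1 + ψ 1) := by fun_prop
    simpa using (this.tendsto 0).mono_left nhdsWithin_le_nhds
  have hnn : ∀ z v : Fin n → ℝ, 0 ≤ v ⬝ᵥ (symProd z z *ᵥ v) := fun z v => by
    rw [dotProduct_symProd_self]; positivity
  have hφ : ∀ v, 0 ≤ φ (symProd v v) := fun v => by
    simpa using hadd (symProd v v) 0 (hnn v) (by simp)
  have hψ : ∀ v, 0 ≤ ψ (symProd v v) := fun v => by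
    simpa using hadd 0 (symProd v v) (by simp) (hnn v)
  have hident : ∀ u z : Fin n → ℝ,
      g (symProd (A₀ *ᵥ u) z) + g (symProd u (A₀ *ᵥ z)) +
        (g (symProd (G *ᵥ u) z) + g (symProd u (G *ᵥ z))) =
      -(φ (symProd (G *ᵥ u) z) + φ (symProd u (G *ᵥ z)) + ψ (symProd u z)) := by
    intro u z
    have h := hg (vecMulVec u z, 0)
    have hσ : σ (vecMulVec u z, 0) = (lyap G (sym (vecMulVec u z)), sym (vecMulVec u z)) := rfl
    have hτ : τ (vecMulVec u z, 0) =
      lyap A₀ (sym (vecMulVec u z)) + inp 0 + lyap G (sym (vecMulVec u z)) := rfl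
    rw [hσ, hτ, hsymQ, hlyap, hlyap, mul_symProd_add, mul_symProd_add, hf, map_zero, add_zero]
      at h
    simpa only [map_add] using h
  -- from vanishing of `g` at `u` to vanishing of `φ` and `ψ` at `u` and of `g` at `A₀ u`
  have hstep : ∀ k : ℕ, ∀ u : Fin n → ℝ, (∃ x, (A₀ ^ k * B) *ᵥ x = u) →
      (∀ z, g (symProd u z) = 0) →
      (∀ z, φ (symProd u z) = 0 ∧ ψ (symProd u z) = 0) ∧ ∀ z, g (symProd (A₀ *ᵥ u) z) = 0 := by
    rintro k u ⟨x, rfl⟩ hgu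
    set u := (A₀ ^ k * B) *ᵥ x with hu
    have hGu : G *ᵥ u = γ k • u := by rw [hu, mulVec_mulVec, hG, smul_mulVec]
    have hmain : ∀ z, φ (symProd u z) = 0 ∧ ψ (symProd u z) = 0 := by
      by_cases hu0 : u = 0
      · intro z; rw [hu0, symProd_zero_left]; simp
      have hpos : 0 < γ k := hγ k fun h => hu0 (by rw [hu, h, zero_mulVec])
      have h := hident u u
      rw [hGu, symProd_comm _ u, symProd_comm (γ k • u), hgu, hgu, symProd_comm u (γ k • u),
        symProd_smul_left, map_smul, smul_eq_mul] at h
      have h1 := mul_nonneg hpos.le (hφ u)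
      have h2 := hψ u
      have h3 : φ (symProd u u) = 0 :=
        (mul_eq_zero.mp (by linarith : γ k * φ (symProd u u) = 0)).resolve_left hpos.ne'
      exact fun z => ⟨map_symProd_eq_zero hφ h3 z, map_symProd_eq_zero hψ (by linarith) z⟩
    refine ⟨hmain, fun z => ?_⟩
    have h := hident u z
    rw [hGu, symProd_smul_left, map_smul, map_smul, hgu, hgu, hgu, (hmain z).1, (hmain z).2,
      (hmain _).1] at h
    simpa using h
  have hg0 : ∀ k : ℕ, ∀ x z, g (symProd ((A₀ ^ k * B) *ᵥ x) z) = 0 := by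
    intro k
    induction k with
    | zero =>
      intro x z
      have h := hg (0, vecMulVec x z)
      have hσ : σ (0, vecMulVec x z) = (lyap G (sym 0), sym 0) := rfl
      have hτ : τ (0, vecMulVec x z) = lyap A₀ (sym 0) + inp (vecMulVec x z) + lyap G (sym 0) := rfl
      rw [hσ, hτ, map_zero, map_zero, map_zero, zero_add, add_zero, hinp, transpose_vecMulVec,
        mul_vecMulVec, vecMulVec_mul, vecMul_transpose, hf, map_zero, map_zero] at h
      simpa [symProd] using h
    | succ k ih =>
      intro x z
      rw [pow_succ', Matrix.mul_assoc, ← mulVec_mulVec]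
      exact (hstep k _ ⟨x, rfl⟩ (ih x)).2 z
  let W : Submodule ℝ (Fin n → ℝ) :=
    { carrier := {u | ∀ z, φ (symProd u z) = 0 ∧ ψ (symProd u z) = 0}
      zero_mem' := fun z => by rw [symProd_zero_left]; simp
      add_mem' := fun {u v} hu hv z => by
        rw [symProd_add_left, map_add, map_add, (hu z).1, (hu z).2, (hv z).1, (hv z).2]; simp
      smul_mem' := fun c u hu z => by
        rw [symProd_smul_left, map_smul, map_smul, (hu z).1, (hu z).2]; simp }
  have hW : ∀ k x, (A₀ ^ k * B) *ᵥ x ∈ W := fun k x => (hstep k _ ⟨x, rfl⟩ (hg0 k x)).1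
  have hWtop : W = ⊤ := by
    by_contra hne
    obtain ⟨χ, hχ0, hχ⟩ := W.exists_le_ker_of_lt_top (lt_top_iff_ne_top.mpr hne)
    have hχdot : ∀ u, χ u = (fun i => χ (Pi.single i 1)) ⬝ᵥ u := fun u => by
      conv_lhs => rw [pi_eq_sum_univ' u]
      simp only [map_sum, map_smul, dotProduct, smul_eq_mul]
      exact Finset.sum_congr rfl fun i _ => mul_comm _ _
    apply hχ0
    have h0 := hspan (fun i => χ (Pi.single i 1)) fun k => by
      refine dotProduct_eq_zero _ fun x => ?_
      rw [← dotProduct_mulVec, ← hχdot]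
      exact hχ (hW k x)
    ext i
    simpa using congrFun h0 i
  have hall : ∀ u z, φ (symProd u z) = 0 ∧ ψ (symProd u z) = 0 := fun u =>
    (hWtop ▸ Submodule.mem_top : u ∈ W)
  have h1 : φ 1 = 0 ∧ ψ 1 = 0 := by
    constructor
    · have h : φ ((2 : ℝ) • (1 : E)) = 0 := by
        rw [← sum_symProd_single, map_sum]; exact Finset.sum_eq_zero fun i _ => (hall _ _).1
      rw [map_smul] at h
      exact (smul_eq_zero.mp h).resolve_left two_ne_zero
    · have h : ψ ((2 : ℝ) • (1 : E)) = 0 := by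
        rw [← sum_symProd_single, map_sum]; exact Finset.sum_eq_zero fun i _ => (hall _ _).2
      rw [map_smul] at h
      exact (smul_eq_zero.mp h).resolve_left two_ne_zero
  have h2 := hfO _ hO1
  rw [hf, h1.1, h1.2] at h2
  linarith

theorem SolvesGeneratorEq.exists_solvesLMI {A : Matrix (Fin n) (Fin n) ℝ}
    {B : Matrix (Fin n) (Fin m) ℝ} {Y₀ : Matrix (Fin m) (Fin n) ℝ} {G₀ : Matrix (Fin n) (Fin n) ℝ}
    (hG : SolvesGeneratorEq A B Y₀ G₀) (hAB : IsControllablePair A B) {μ : ℝ}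
    (hμ : μ ≤ 1 / (controllabilityIndex A B : ℝ)) :
    ∃ X Y, SolvesLMI (shiftedMatrix A B Y₀ G₀) B (dilationGenerator G₀ μ) X Y := by
  have heig := pow_mul_eigenvector (hG.shiftedMatrix_commutator hAB) hG.2 μ
  refine HomStab.exists_solvesLMI heig (fun k hk => ?_)
    (fun w hw => eq_zero_of_vecMul_feedback hAB _ hw)
  -- a nonzero column of `A₀ᵏ B` is an eigenvector of the anti-Hurwitz matrix `I + μ G₀`
  obtain ⟨l, hl⟩ : ∃ l, (fun i => (shiftedMatrix A B Y₀ G₀ ^ k * B) i l) ≠ 0 := by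
    by_contra! h
    exact hk (by ext i l; exact congrFun (h l) i)
  have hspec : ((1 - μ * k : ℝ) : ℂ) ∈
      spectrum ℂ ((dilationGenerator G₀ μ).map (algebraMap ℝ ℂ)) := by
    rw [spectrum.mem_iff, isUnit_iff_isUnit_det, isUnit_iff_ne_zero, not_not]
    have hdet :
        ((1 - μ * k) • (1 : Matrix (Fin n) (Fin n) ℝ) - dilationGenerator G₀ μ).det = 0 := by
      refine exists_mulVec_eq_zero_iff.mp ⟨_, hl, ?_⟩
      rw [sub_mulVec, smul_mulVec, one_mulVec, sub_eq_zero]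
      ext i
      have := congrFun (congrFun (heig k) i) l
      simpa [Matrix.mul_apply, mulVec, dotProduct] using this.symm
    have h := congrArg (algebraMap ℝ ℂ) hdet
    rw [RingHom.map_det, map_zero] at h
    rw [← h, Algebra.algebraMap_eq_smul_one]
    congr 1
    ext i j
    simp [Matrix.one_apply, apply_ite]
  simpa using hG.isAntiHurwitz hAB hμ _ hspec

end LMI

/-! ### The linear group generated by a matrix -/

section LinearGroup

open Matrix Filter Topology
open scoped Matrix.Norms.Operator

variable {n : ℕ}

lemma dil_zero (G : Matrix (Fin n) (Fin n) ℝ) : dil G 0 = 1 := by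
  simp [dil]

lemma dil_add (G : Matrix (Fin n) (Fin n) ℝ) (s t : ℝ) : dil G (s + t) = dil G s * dil G t := by
  rw [dil, add_smul, Matrix.exp_add_of_commute]
  · rfl
  · exact ((Commute.refl G).smul_left s).smul_right t

lemma dil_mulVec_dil_mulVec (G : Matrix (Fin n) (Fin n) ℝ) (s t : ℝ) (x : Fin n → ℝ) :
    dil G s *ᵥ (dil G t *ᵥ x) = dil G (s + t) *ᵥ x := by
  rw [mulVec_mulVec, dil_add]

lemma dil_mulVec_eq_zero {G : Matrix (Fin n) (Fin n) ℝ} {s : ℝ} {x : Fin n → ℝ} :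
    dil G s *ᵥ x = 0 ↔ x = 0 := by
  refine ⟨fun h => ?_, fun h => by rw [h, mulVec_zero]⟩
  have := congrArg (dil G (-s) *ᵥ ·) h
  simpa only [dil_mulVec_dil_mulVec, neg_add_cancel, dil_zero, one_mulVec, mulVec_zero] using this

/-- The action of a matrix on a fixed vector, as a continuous linear map in the matrix. -/
noncomputable def mulVecCLM (x : Fin n → ℝ) : Matrix (Fin n) (Fin n) ℝ →L[ℝ] (Fin n → ℝ) :=
  LinearMap.toContinuousLinearMap
    { toFun := fun M => M *ᵥ x
      map_add' := fun M N => add_mulVec M N x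
      map_smul' := fun c M => smul_mulVec c M x }

lemma hasDerivAt_dil (G : Matrix (Fin n) (Fin n) ℝ) (s : ℝ) :
    HasDerivAt (dil G) (G * dil G s) s :=
  hasDerivAt_exp_smul_const' (𝕂 := ℝ) G s

lemma hasDerivAt_dil_mulVec (G : Matrix (Fin n) (Fin n) ℝ) (x : Fin n → ℝ) (s : ℝ) :
    HasDerivAt (fun s => dil G s *ᵥ x) (G *ᵥ (dil G s *ᵥ x)) s := by
  rw [mulVec_mulVec]
  exact (mulVecCLM x).hasFDerivAt.comp_hasDerivAt s (hasDerivAt_dil G s)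

lemma contDiff_mulVec : ContDiff ℝ 1 fun p : Matrix (Fin n) (Fin n) ℝ × (Fin n → ℝ) =>
    p.1 *ᵥ p.2 := by
  refine contDiff_pi.mpr fun i => ?_
  simp only [mulVec, dotProduct]
  refine ContDiff.sum fun j _ => ContDiff.mul ?_ ?_
  · exact ((LinearMap.toContinuousLinearMap (Matrix.entryLinearMap ℝ ℝ i j)).contDiff).comp
      contDiff_fst
  · exact (contDiff_apply ℝ ℝ j).comp contDiff_snd

lemma contDiff_dil (G : Matrix (Fin n) (Fin n) ℝ) : ContDiff ℝ 1 (dil G) := by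
  refine contDiff_iff_contDiffAt.mpr fun s => ?_
  exact (NormedSpace.exp_analytic (𝕂 := ℝ) (s • G)).contDiffAt.comp s
    (contDiff_id.smul contDiff_const).contDiffAt

lemma contDiff_dil_mulVec (G : Matrix (Fin n) (Fin n) ℝ) :
    ContDiff ℝ 1 fun p : ℝ × (Fin n → ℝ) => dil G p.1 *ᵥ p.2 :=
  contDiff_mulVec.comp (((contDiff_dil G).comp contDiff_fst).prodMk contDiff_snd)

lemma contDiff_const_mulVec {m : ℕ} (M : Matrix (Fin m) (Fin n) ℝ) :
    ContDiff ℝ 1 fun x : Fin n → ℝ => M *ᵥ x :=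
  (LinearMap.toContinuousLinearMap M.mulVecLin).contDiff

lemma dil_mul_eq_exp_smul_of_fixed {m : ℕ} {G : Matrix (Fin n) (Fin n) ℝ}
    {M : Matrix (Fin n) (Fin m) ℝ} (h : G * M = M) (s : ℝ) : dil G s * M = Real.exp s • M := by
  ext i l
  -- for a fixed vector `x` of `G`, the curve `exp (-t) d(t) x` has zero derivative
  have key : ∀ x : Fin n → ℝ, G *ᵥ x = x → dil G s *ᵥ x = Real.exp s • x := by
    intro x hx
    have hGd : ∀ t, G *ᵥ (dil G t *ᵥ x) = dil G t *ᵥ x := by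
      intro t
      have hc : G * dil G t = dil G t * G :=
        (((Commute.refl G).smul_right t).exp_right).eq
      rw [mulVec_mulVec, hc, ← mulVec_mulVec, hx]
    have hder : ∀ t, HasDerivAt (fun t => Real.exp (-t) • (dil G t *ᵥ x)) 0 t := by
      intro t
      have h1 := ((hasDerivAt_neg t).exp).smul (hasDerivAt_dil_mulVec G x t)
      rw [hGd] at h1
      convert! h1 using 1
      simp
    have hconst := is_const_of_deriv_eq_zero (fun t => (hder t).differentiableAt)
      (fun t => (hder t).deriv) s 0
    simp only [neg_zero, Real.exp_zero, dil_zero, one_mulVec, one_smul] at hconst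
    rw [← one_smul ℝ (dil G s *ᵥ x), ← Real.exp_zero, ← add_neg_cancel s, Real.exp_add, ← smul_smul,
      hconst]
  have := congrFun (key (fun i => M i l) (funext fun i => congrFun (congrFun h i) l)) i
  simpa [mulVec, dotProduct, Matrix.mul_apply] using this

/-- If `G M = M (G + 1)`, that is, if `M` is homogeneous of degree `-1`, then conjugation by the
dilation scales `M`. -/
lemma dil_mul_eq_exp_smul {G M : Matrix (Fin n) (Fin n) ℝ} (h : G * M = M * (G + 1)) (s : ℝ) :
    dil G s * M = Real.exp s • (M * dil G s) := by
  have h1 : SemiconjBy M (s • (G + 1)) (s • G) := by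
    rw [SemiconjBy, Matrix.mul_smul, Matrix.smul_mul, h]
  have h2 := h1.exp_right
  have h3 : NormedSpace.exp (s • (G + 1)) = Real.exp s • dil G s := by
    rw [smul_add, Matrix.exp_add_of_commute _ _ (((Commute.one_right G).smul_right s).smul_left s)]
    have : NormedSpace.exp (s • (1 : Matrix (Fin n) (Fin n) ℝ)) = Real.exp s • 1 := by
      have h4 := dil_mul_eq_exp_smul_of_fixed (one_mul (1 : Matrix (Fin n) (Fin n) ℝ)) s
      rw [mul_one] at h4
      exact h4
    rw [this, Matrix.mul_smul, mul_one]
    rfl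
  rw [← Matrix.mul_smul, ← h3]
  exact h2.eq.symm

end LinearGroup

/-! ### Quadratic forms -/

section QuadraticForm

open Matrix Filter Topology

variable {n : ℕ}

/-- The quadratic form `vᵀ P v`. -/
noncomputable def qform (P : Matrix (Fin n) (Fin n) ℝ) (v : Fin n → ℝ) : ℝ := v ⬝ᵥ (P *ᵥ v)

lemma qform_smul (P : Matrix (Fin n) (Fin n) ℝ) (c : ℝ) (v : Fin n → ℝ) :
    qform P (c • v) = c ^ 2 * qform P v := by
  simp only [qform, mulVec_smul, dotProduct_smul, smul_dotProduct, smul_eq_mul]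
  ring

lemma qform_pos {P : Matrix (Fin n) (Fin n) ℝ} (hP : P.PosDef) {v : Fin n → ℝ} (hv : v ≠ 0) :
    0 < qform P v := by
  simpa [qform] using hP.dotProduct_mulVec_pos hv

lemma qform_nonneg {P : Matrix (Fin n) (Fin n) ℝ} (hP : P.PosDef) (v : Fin n → ℝ) :
    0 ≤ qform P v := by
  simpa [qform] using hP.posSemidef.dotProduct_mulVec_nonneg v

lemma contDiff_qform (P : Matrix (Fin n) (Fin n) ℝ) : ContDiff ℝ 1 (qform P) := by
  unfold qform
  simp only [dotProduct]
  exact ContDiff.sum fun j _ => (contDiff_apply ℝ ℝ j).mul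
    ((contDiff_apply ℝ ℝ j).comp (contDiff_const_mulVec P))

lemma exists_mul_qform_le {P R : Matrix (Fin n) (Fin n) ℝ} (hP : P.PosDef) (hR : R.PosDef) :
    ∃ α > 0, ∀ v, α * qform P v ≤ qform R v := by
  rcases (Metric.sphere (0 : Fin n → ℝ) 1).eq_empty_or_nonempty with he | hne
  · refine ⟨1, one_pos, fun v => ?_⟩
    have hv : v = 0 := by
      by_contra hv
      have : (‖v‖⁻¹ • v) ∈ Metric.sphere (0 : Fin n → ℝ) 1 := by
        simp [norm_smul, (norm_pos_iff.mpr hv).ne']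
      rw [he] at this
      exact this
    simp [hv, qform]
  have hsph : ∀ v ∈ Metric.sphere (0 : Fin n → ℝ) 1, v ≠ 0 := by rintro v hv rfl; simp at hv
  obtain ⟨w, hw, hmin⟩ := (isCompact_sphere (0 : Fin n → ℝ) 1).exists_isMinOn hne
    (f := fun v => qform R v / qform P v)
    ((contDiff_qform R).continuous.continuousOn.div (contDiff_qform P).continuous.continuousOn
      fun v hv => (qform_pos hP (hsph v hv)).ne')
  refine ⟨qform R w / qform P w, div_pos (qform_pos hR (hsph w hw)) (qform_pos hP (hsph w hw)),
    fun v => ?_⟩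
  by_cases hv : v = 0
  · simp [hv, qform]
  have hv' : ‖v‖ ≠ 0 := (norm_pos_iff.mpr hv).ne'
  have h := hmin (show ‖v‖⁻¹ • v ∈ Metric.sphere (0 : Fin n → ℝ) 1 by simp [norm_smul, hv'])
  simp only [Set.mem_ofPred_eq, qform_smul] at h
  rw [mul_div_mul_left _ _ (by positivity), le_div_iff₀ (qform_pos hP hv)] at h
  exact h

lemma exists_mul_norm_sq_le_qform {P : Matrix (Fin n) (Fin n) ℝ} (hP : P.PosDef) :
    ∃ β > 0, ∀ v : Fin n → ℝ, β * ‖v‖ ^ 2 ≤ qform P v := by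
  obtain ⟨β, hβ, h⟩ := exists_mul_qform_le (Matrix.PosDef.one (n := Fin n) (R := ℝ)) hP
  refine ⟨β, hβ, fun v => le_trans ?_ (h v)⟩
  refine mul_le_mul_of_nonneg_left ?_ hβ.le
  have h0 : 0 ≤ qform 1 v := qform_nonneg Matrix.PosDef.one v
  have h1 : ‖v‖ ≤ √(qform 1 v) := by
    refine (pi_norm_le_iff_of_nonneg (Real.sqrt_nonneg _)).mpr fun i => ?_
    refine Real.le_sqrt_of_sq_le ?_
    rw [Real.norm_eq_abs, sq_abs, qform, one_mulVec, dotProduct, sq]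
    exact Finset.single_le_sum (f := fun i => v i * v i) (fun j _ => mul_self_nonneg _)
      (Finset.mem_univ i)
  calc ‖v‖ ^ 2 ≤ √(qform 1 v) ^ 2 := by gcongr
    _ = qform 1 v := Real.sq_sqrt h0

lemma hasDerivAt_qform_dil {P : Matrix (Fin n) (Fin n) ℝ} (G : Matrix (Fin n) (Fin n) ℝ)
    (x : Fin n → ℝ) (s : ℝ) :
    HasDerivAt (fun s => qform P (dil G s *ᵥ x)) (qform (P * G + Gᵀ * P) (dil G s *ᵥ x)) s := by
  have h1 := hasDerivAt_dil_mulVec G x s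
  have h2 : HasDerivAt (fun s => P *ᵥ (dil G s *ᵥ x)) (P *ᵥ (G *ᵥ (dil G s *ᵥ x))) s :=
    (LinearMap.toContinuousLinearMap P.mulVecLin).hasFDerivAt.comp_hasDerivAt s h1
  have h3 := HasDerivAt.fun_sum (u := Finset.univ) fun j _ =>
    ((hasDerivAt_pi.mp h1) j).mul ((hasDerivAt_pi.mp h2) j)
  refine h3.congr_deriv ?_
  rw [Finset.sum_add_distrib]
  change (G *ᵥ (dil G s *ᵥ x)) ⬝ᵥ (P *ᵥ (dil G s *ᵥ x)) +
    (dil G s *ᵥ x) ⬝ᵥ (P *ᵥ (G *ᵥ (dil G s *ᵥ x))) = _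
  rw [qform, add_mulVec, dotProduct_add, ← mulVec_mulVec, ← mulVec_mulVec, add_comm,
    dotProduct_mulVec _ Gᵀ, vecMul_transpose]

end QuadraticForm

/-! ### The canonical homogeneous norm -/

section HomogeneousNorm

open Matrix Filter Topology

variable {n : ℕ} {X G : Matrix (Fin n) (Fin n) ℝ}

lemma SolvesLMI.posDef_inv {m : ℕ} {A₀ : Matrix (Fin n) (Fin n) ℝ} {B : Matrix (Fin n) (Fin m) ℝ}
    {Y : Matrix (Fin m) (Fin n) ℝ} (h : SolvesLMI A₀ B G X Y) :
    X⁻¹.PosDef ∧ (X⁻¹ * G + Gᵀ * X⁻¹).PosDef := by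
  obtain ⟨-, h2, h3⟩ := h
  have hdet := (isUnit_iff_isUnit_det _).mp h3.isUnit
  refine ⟨h3.inv, ?_⟩
  have h4 := (IsUnit.posDef_star_right_conjugate_iff (h3.inv.isUnit)).mpr h2
  rw [star_eq_conjTranspose, h3.inv.1] at h4
  convert! h4 using 1
  rw [mul_add, add_mul, Matrix.mul_assoc, Matrix.mul_assoc, mul_nonsing_inv _ hdet, mul_one,
    ← Matrix.mul_assoc X⁻¹ X, nonsing_inv_mul _ hdet, one_mul]

/-- With `P = X⁻¹`, the matrix equation says that `A₀ + B Y X⁻¹ + G` is skew-symmetric for the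
inner product of `P`. -/
lemma SolvesLMI.skew {m : ℕ} {A₀ : Matrix (Fin n) (Fin n) ℝ} {B : Matrix (Fin n) (Fin m) ℝ}
    {Y : Matrix (Fin m) (Fin n) ℝ} (h : SolvesLMI A₀ B G X Y) :
    X⁻¹ * (A₀ + B * (Y * X⁻¹) + G) + (A₀ + B * (Y * X⁻¹) + G)ᵀ * X⁻¹ = 0 := by
  obtain ⟨h1, -, h3⟩ := h
  have hdet := (isUnit_iff_isUnit_det _).mp h3.isUnit
  have hXt : Xᵀ = X := by
    rw [← conjTranspose_eq_transpose_of_trivial]; exact h3.1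
  have hH : (A₀ + B * (Y * X⁻¹) + G) * X = A₀ * X + B * Y + G * X := by
    rw [add_mul, add_mul, Matrix.mul_assoc, Matrix.mul_assoc, nonsing_inv_mul _ hdet,
      Matrix.mul_one]
  have hHt : X * (A₀ + B * (Y * X⁻¹) + G)ᵀ = X * A₀ᵀ + Yᵀ * Bᵀ + X * Gᵀ := by
    have := congrArg transpose hH
    simpa only [transpose_mul, transpose_add, hXt] using this
  set H := A₀ + B * (Y * X⁻¹) + G
  have hsum : H * X + X * Hᵀ = 0 := by
    rw [hH, hHt, ← h1]; abel
  have h5 : X⁻¹ * (H * X + X * Hᵀ) * X⁻¹ = X⁻¹ * H + Hᵀ * X⁻¹ := by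
    rw [mul_add, add_mul, Matrix.mul_assoc, Matrix.mul_assoc, mul_nonsing_inv _ hdet, mul_one,
      ← Matrix.mul_assoc X⁻¹ X, nonsing_inv_mul _ hdet, one_mul]
  rw [← h5, hsum, Matrix.mul_zero, Matrix.zero_mul]

lemma weightedNorm_eq (T : ℝ) (x : Fin n → ℝ) :
    weightedNorm X G T x = √(qform X⁻¹ (dil G (-Real.log T) *ᵥ x)) := rfl

lemma weightedNorm_smul (T c : ℝ) (x : Fin n → ℝ) :
    weightedNorm X G T (c • x) = |c| * weightedNorm X G T x := by
  rw [weightedNorm_eq, weightedNorm_eq, mulVec_smul, qform_smul, Real.sqrt_mul (sq_nonneg _),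
    Real.sqrt_sq_eq_abs]

lemma weightedNorm_dil (T s : ℝ) (x : Fin n → ℝ) :
    weightedNorm X G T (dil G s *ᵥ x) =
      √(qform X⁻¹ (dil G s *ᵥ (dil G (-Real.log T) *ᵥ x))) := by
  rw [weightedNorm_eq, dil_mulVec_dil_mulVec, dil_mulVec_dil_mulVec, add_comm]

lemma weightedNorm_pos (hP : X⁻¹.PosDef) (T : ℝ) {x : Fin n → ℝ} (hx : x ≠ 0) :
    0 < weightedNorm X G T x :=
  Real.sqrt_pos.mpr (qform_pos hP (mt dil_mulVec_eq_zero.mp hx))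

/-- Exponential growth of the form `P` along the dilation: its derivative is the positive definite
form `P G + Gᵀ P`, which dominates a multiple of `P`. -/
lemma exists_exp_mul_qform_dil_le {P : Matrix (Fin n) (Fin n) ℝ} (hP : P.PosDef)
    (hG : (P * G + Gᵀ * P).PosDef) :
    ∃ α > 0, ∀ x : Fin n → ℝ, ∀ s t : ℝ, s ≤ t →
      Real.exp (α * (t - s)) * qform P (dil G s *ᵥ x) ≤ qform P (dil G t *ᵥ x) := by
  obtain ⟨α, hα, h⟩ := exists_mul_qform_le hP hG
  refine ⟨α, hα, fun x s t hst => ?_⟩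
  have hder : ∀ t : ℝ, HasDerivAt (fun t => Real.exp (-(α * t)) * qform P (dil G t *ᵥ x))
      (Real.exp (-(α * t)) * (qform (P * G + Gᵀ * P) (dil G t *ᵥ x) -
        α * qform P (dil G t *ᵥ x))) t := by
    intro t
    have h1 : HasDerivAt (fun t : ℝ => -(α * t)) (-(α * 1)) t := ((hasDerivAt_id t).const_mul α).neg
    have h2 := h1.exp.mul (hasDerivAt_qform_dil (P := P) G x t)
    exact h2.congr_deriv (by ring)
  have hmono : Monotone fun t => Real.exp (-(α * t)) * qform P (dil G t *ᵥ x) := by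
    refine monotone_of_deriv_nonneg (fun t => (hder t).differentiableAt) fun t => ?_
    rw [(hder t).deriv]
    exact mul_nonneg (Real.exp_pos _).le (sub_nonneg.mpr (h _))
  have h3 := hmono hst
  have h4 := mul_le_mul_of_nonneg_left h3 (Real.exp_pos (α * t)).le
  rw [← mul_assoc, ← mul_assoc, ← Real.exp_add, ← Real.exp_add] at h4
  ring_nf at h4 ⊢
  simpa using h4

theorem isMonotoneDilation_weightedNorm (hP : X⁻¹.PosDef) (hG : (X⁻¹ * G + Gᵀ * X⁻¹).PosDef)
    (T : ℝ) : IsMonotoneDilation (weightedNorm X G T) G := by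
  obtain ⟨α, hα, h⟩ := exists_exp_mul_qform_dil_le hP hG
  intro x hx
  simp only [weightedNorm_dil]
  set y := dil G (-Real.log T) *ᵥ x
  have hy : y ≠ 0 := mt dil_mulVec_eq_zero.mp hx
  have hy0 : 0 < qform X⁻¹ y := qform_pos hP hy
  have hd0 : dil G 0 *ᵥ y = y := by rw [dil_zero, one_mulVec]
  refine ⟨?_, ?_, ?_⟩
  · refine Real.tendsto_sqrt_atTop.comp (tendsto_atTop_mono' _ (f₁ := fun s =>
      Real.exp (α * s) * qform X⁻¹ y) ?_ ?_)
    · filter_upwards [eventually_ge_atTop 0] with s hs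
      have := h y 0 s hs
      rwa [hd0, sub_zero] at this
    · exact (Real.tendsto_exp_atTop.comp (tendsto_id.const_mul_atTop hα)).atTop_mul_const hy0
  · rw [← Real.sqrt_zero]
    refine (Real.continuous_sqrt.tendsto 0).comp ?_
    refine tendsto_of_tendsto_of_tendsto_of_le_of_le' tendsto_const_nhds
      (h := fun s => Real.exp (α * s) * qform X⁻¹ y) ?_ ?_ ?_
    · have : Tendsto (fun s : ℝ => Real.exp (α * s)) atBot (𝓝 0) :=
        Real.tendsto_exp_atBot.comp (tendsto_id.const_mul_atBot hα)
      simpa using this.mul_const (qform X⁻¹ y)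
    · exact Eventually.of_forall fun s => qform_nonneg hP _
    · filter_upwards [eventually_le_atBot 0] with s hs
      have h1 := h y s 0 hs
      rw [hd0, zero_sub] at h1
      have h2 := mul_le_mul_of_nonneg_left h1 (Real.exp_pos (α * s)).le
      rwa [← mul_assoc, ← Real.exp_add, mul_neg, add_neg_cancel, Real.exp_zero, one_mul] at h2
  · intro s t hst
    refine Real.sqrt_lt_sqrt (qform_nonneg hP _) ?_
    have hpos : 0 < qform X⁻¹ (dil G s *ᵥ y) := qform_pos hP (mt dil_mulVec_eq_zero.mp hy)
    have h1 : 1 < Real.exp (α * (t - s)) := Real.one_lt_exp_iff.mpr (mul_pos hα (sub_pos.mpr hst))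
    exact (lt_mul_of_one_lt_left hpos h1).trans_le (h y s t hst.le)

theorem existsUnique_weightedNorm_eq_one (hP : X⁻¹.PosDef)
    (hG : (X⁻¹ * G + Gᵀ * X⁻¹).PosDef) (T : ℝ) {x : Fin n → ℝ} (hx : x ≠ 0) :
    ∃! s : ℝ, weightedNorm X G T (dil G (-s) *ᵥ x) = 1 := by
  obtain ⟨htop, hbot, hmono⟩ := isMonotoneDilation_weightedNorm hP hG T x hx
  have hc : Continuous fun s => weightedNorm X G T (dil G s *ᵥ x) := by
    simp only [weightedNorm_dil]
    exact Real.continuous_sqrt.comp ((contDiff_qform X⁻¹).continuous.comp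
      ((contDiff_dil_mulVec G).continuous.comp (continuous_id.prodMk continuous_const)))
  obtain ⟨a, ha⟩ := (hbot.eventually (gt_mem_nhds one_pos)).exists
  obtain ⟨b, hb⟩ := (htop.eventually (eventually_ge_atTop 1)).exists
  obtain ⟨s, hs⟩ := mem_range_of_exists_le_of_exists_ge hc ⟨a, ha.le⟩ ⟨b, hb⟩
  refine ⟨-s, by simpa using hs, fun t ht => ?_⟩
  have : -t = s := hmono.injective (ht.trans hs.symm)
  linarith

lemma homNorm_eq_exp (hP : X⁻¹.PosDef) (hG : (X⁻¹ * G + Gᵀ * X⁻¹).PosDef) {T : ℝ}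
    {x : Fin n → ℝ} (hx : x ≠ 0) {s : ℝ} (hs : weightedNorm X G T (dil G (-s) *ᵥ x) = 1) :
    homNorm (weightedNorm X G T) G x = Real.exp s := by
  rw [homNorm, if_neg hx]
  congr 1
  exact (existsUnique_weightedNorm_eq_one hP hG T hx).unique
    (Classical.epsilon_spec (p := fun s => weightedNorm X G T (dil G (-s) *ᵥ x) = 1) ⟨s, hs⟩) hs

lemma weightedNorm_dil_log_homNorm (hP : X⁻¹.PosDef) (hG : (X⁻¹ * G + Gᵀ * X⁻¹).PosDef) {T : ℝ}
    {x : Fin n → ℝ} (hx : x ≠ 0) :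
    weightedNorm X G T (dil G (-Real.log (homNorm (weightedNorm X G T) G x)) *ᵥ x) = 1 := by
  obtain ⟨s, hs, -⟩ := existsUnique_weightedNorm_eq_one hP hG T hx
  rw [homNorm_eq_exp hP hG hx hs, Real.log_exp]
  exact hs

lemma homNorm_neg (T : ℝ) (x : Fin n → ℝ) :
    homNorm (weightedNorm X G T) G (-x) = homNorm (weightedNorm X G T) G x := by
  have h : ∀ y, weightedNorm X G T (-y) = weightedNorm X G T y := fun y => by
    rw [← neg_one_smul ℝ y, weightedNorm_smul]; simp
  simp only [homNorm, neg_eq_zero, mulVec_neg, h]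

/-- By the implicit function theorem, the canonical homogeneous norm is smooth away from the
origin. -/
lemma contDiffAt_log_homNorm (hP : X⁻¹.PosDef) (hG : (X⁻¹ * G + Gᵀ * X⁻¹).PosDef) {T : ℝ}
    {x : Fin n → ℝ} (hx : x ≠ 0) :
    ContDiffAt ℝ 1 (fun y => Real.log (homNorm (weightedNorm X G T) G y)) x := by
  set S : (Fin n → ℝ) → ℝ := fun y => Real.log (homNorm (weightedNorm X G T) G y) with hSdef
  let Φ : (Fin n → ℝ) × ℝ → ℝ := fun p =>
    qform X⁻¹ (dil G (-p.2) *ᵥ (dil G (-Real.log T) *ᵥ p.1))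
  have hΦ : ContDiff ℝ 1 Φ :=
    (contDiff_qform X⁻¹).comp ((contDiff_dil_mulVec G).comp
      (contDiff_snd.neg.prodMk ((contDiff_const_mulVec _).comp contDiff_fst)))
  have hΦN : ∀ y s, weightedNorm X G T (dil G (-s) *ᵥ y) = √(Φ (y, s)) := fun y s =>
    weightedNorm_dil T (-s) y
  have hone : ∀ y ≠ 0, Φ (y, S y) = 1 := fun y hy => by
    have h := weightedNorm_dil_log_homNorm (T := T) hP hG hy
    rwa [hΦN, Real.sqrt_eq_one] at h
  set u : (Fin n → ℝ) × ℝ := (x, S x) with hu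
  -- the derivative in the second variable is minus a positive definite quadratic form
  set z := dil G (-S x) *ᵥ (dil G (-Real.log T) *ᵥ x) with hz
  have hz0 : z ≠ 0 := mt (dil_mulVec_eq_zero.mp ∘ dil_mulVec_eq_zero.mp) hx
  set c := -qform (X⁻¹ * G + Gᵀ * X⁻¹) z with hc
  have hc0 : c ≠ 0 := (neg_neg_of_pos (qform_pos hG hz0)).ne
  have hpart : HasDerivAt (fun s => Φ (x, s)) c (S x) := by
    have h1 := (hasDerivAt_qform_dil (P := X⁻¹) G (dil G (-Real.log T) *ᵥ x) (-S x)).scomp (S x)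
      (hasDerivAt_neg (S x))
    exact h1.congr_deriv (by rw [hc]; simp [hz])
  have hpart' : HasDerivAt (fun s => Φ (x, s))
      ((fderiv ℝ Φ u ∘L .inr ℝ (Fin n → ℝ) ℝ) 1) (S x) := by
    have h1 : HasFDerivAt Φ (fderiv ℝ Φ u) (x, S x) :=
      (hΦ.differentiable one_ne_zero u).hasFDerivAt
    have h2 := h1.comp_hasDerivAt (S x) ((hasDerivAt_const (S x) x).prodMk (hasDerivAt_id (S x)))
    exact h2
  have hinv : (fderiv ℝ Φ u ∘L .inr ℝ (Fin n → ℝ) ℝ).IsInvertible := by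
    refine ⟨ContinuousLinearEquiv.unitsEquivAut ℝ (Units.mk0 c hc0), ?_⟩
    ext
    rw [hpart'.unique hpart]
    simp
  have hΦu : ContDiffAt ℝ 1 Φ u := hΦ.contDiffAt
  have h1 := hΦu.contDiffAt_implicitFunction one_ne_zero hinv
  refine h1.congr_of_eventuallyEq ?_
  filter_upwards [hΦu.eventually_apply_implicitFunction one_ne_zero hinv,
    isOpen_ne.mem_nhds hx] with y hy hy0
  refine (existsUnique_weightedNorm_eq_one hP hG T hy0).unique ?_ ?_
  · exact weightedNorm_dil_log_homNorm hP hG hy0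
  · rw [hΦN, hy, hu, hone x hx, Real.sqrt_one]

end HomogeneousNorm

/-! ### Explicit trajectories of the closed loop -/

section Trajectories

open Matrix Filter Topology

variable {n : ℕ} {X G A₀ C : Matrix (Fin n) (Fin n) ℝ}

/-- The closed-loop vector field for an initial state of norm `ν`, with `A₀ = A + B K₀` and
`C = B K`. -/
noncomputable def homField (X G A₀ C : Matrix (Fin n) (Fin n) ℝ) (T ν : ℝ) (y : Fin n → ℝ) :
    Fin n → ℝ :=
  A₀ *ᵥ y + C *ᵥ (dil G (-Real.log T) *ᵥ
    (dil G (-Real.log (homNorm (weightedNorm X G T) G (ν⁻¹ • y))) *ᵥ y))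

/-- The trajectory of the closed loop that reaches the origin at time `a`. The canonical
homogeneous norm of `x / ν` decreases linearly, being `(a - t) / T`, and the projection of
`d(-ln T) x / ν` to the unit sphere moves by the group of isometries generated by `H`. -/
noncomputable def trajectory (G H : Matrix (Fin n) (Fin n) ℝ) (T ν : ℝ) (z : Fin n → ℝ)
    (a t : ℝ) : Fin n → ℝ :=
  ν • (dil G (Real.log (a - t)) *ᵥ (dil H (-Real.log ((a - t) / T)) *ᵥ z))

lemma homField_neg (T ν : ℝ) (y : Fin n → ℝ) :
    homField X G A₀ C T ν (-y) = -homField X G A₀ C T ν y := by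
  simp only [homField, smul_neg, homNorm_neg, mulVec_neg, neg_add]

lemma contDiffAt_homField (hP : X⁻¹.PosDef) (hG : (X⁻¹ * G + Gᵀ * X⁻¹).PosDef) {T ν : ℝ}
    (hν : 0 < ν) {y : Fin n → ℝ} (hy : y ≠ 0) : ContDiffAt ℝ 1 (homField X G A₀ C T ν) y := by
  have h1 : ContDiffAt ℝ 1 (fun y : Fin n → ℝ =>
      Real.log (homNorm (weightedNorm X G T) G (ν⁻¹ • y))) y :=
    ContDiffAt.comp y (contDiffAt_log_homNorm hP hG (smul_ne_zero (inv_ne_zero hν.ne') hy))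
      (contDiff_const_smul ν⁻¹).contDiffAt
  have h2 : ContDiffAt ℝ 1 (fun y : Fin n → ℝ =>
      dil G (-Real.log (homNorm (weightedNorm X G T) G (ν⁻¹ • y))) *ᵥ y) y :=
    (contDiff_dil_mulVec G).contDiffAt.comp y (h1.neg.prodMk contDiffAt_id)
  exact (contDiff_const_mulVec A₀).contDiffAt.add
    ((contDiff_const_mulVec C).contDiffAt.comp y ((contDiff_const_mulVec _).contDiffAt.comp y h2))

/-- A matrix that is skew for the form `P` generates isometries. -/
lemma qform_dil_of_skew {P H : Matrix (Fin n) (Fin n) ℝ} (hH : P * H + Hᵀ * P = 0) (s : ℝ)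
    (z : Fin n → ℝ) : qform P (dil H s *ᵥ z) = qform P z := by
  have hder : ∀ s, HasDerivAt (fun s => qform P (dil H s *ᵥ z)) 0 s := fun s => by
    have h := hasDerivAt_qform_dil (P := P) H z s
    rw [hH] at h
    simpa [qform] using h
  have h := is_const_of_deriv_eq_zero (fun s => (hder s).differentiableAt)
    (fun s => (hder s).deriv) s 0
  simpa [dil_zero] using h

variable {T ν a t : ℝ} {z : Fin n → ℝ}

lemma dil_trajectory {H : Matrix (Fin n) (Fin n) ℝ} (hT : 0 < T) (ht : t < a) :
    dil G (-Real.log T) *ᵥ trajectory G H T ν z a t =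
      ν • (dil G (Real.log ((a - t) / T)) *ᵥ (dil H (-Real.log ((a - t) / T)) *ᵥ z)) := by
  rw [trajectory, mulVec_smul, dil_mulVec_dil_mulVec,
    Real.log_div (sub_pos.mpr ht).ne' hT.ne', neg_add_eq_sub]

lemma trajectory_ne_zero {H P : Matrix (Fin n) (Fin n) ℝ} (hz : qform P z = 1) (hν : 0 < ν) :
    trajectory G H T ν z a t ≠ 0 := by
  refine smul_ne_zero hν.ne' (mt (dil_mulVec_eq_zero.mp ∘ dil_mulVec_eq_zero.mp) ?_)
  rintro rfl
  simp [qform] at hz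

lemma homField_trajectory (hP : X⁻¹.PosDef) (hG : (X⁻¹ * G + Gᵀ * X⁻¹).PosDef)
    {H : Matrix (Fin n) (Fin n) ℝ} (hH : X⁻¹ * H + Hᵀ * X⁻¹ = 0) (hz : qform X⁻¹ z = 1)
    (hT : 0 < T) (hν : 0 < ν) (ht : t < a) :
    homField X G A₀ C T ν (trajectory G H T ν z a t) =
      A₀ *ᵥ trajectory G H T ν z a t + ν • (C *ᵥ (dil H (-Real.log ((a - t) / T)) *ᵥ z)) := by
  -- undoing both dilations leaves `ν` times a unit vector, which determines the homogeneous norm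
  have hcancel : dil G (-Real.log T) *ᵥ (dil G (-Real.log ((a - t) / T)) *ᵥ
      trajectory G H T ν z a t) = ν • (dil H (-Real.log ((a - t) / T)) *ᵥ z) := by
    rw [dil_mulVec_dil_mulVec, add_comm, ← dil_mulVec_dil_mulVec, dil_trajectory hT ht,
      mulVec_smul, dil_mulVec_dil_mulVec, neg_add_cancel, dil_zero, one_mulVec]
  have hnorm : homNorm (weightedNorm X G T) G (ν⁻¹ • trajectory G H T ν z a t) =
      Real.exp (Real.log ((a - t) / T)) := by
    refine homNorm_eq_exp hP hG (smul_ne_zero (inv_ne_zero hν.ne') (trajectory_ne_zero hz hν)) ?_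
    rw [mulVec_smul, weightedNorm_smul, weightedNorm_eq, hcancel, qform_smul,
      qform_dil_of_skew hH, hz, mul_one, Real.sqrt_sq hν.le, abs_of_pos (inv_pos.mpr hν),
      inv_mul_cancel₀ hν.ne']
  rw [homField, hnorm, Real.log_exp, hcancel, mulVec_smul]

open scoped Matrix.Norms.Operator in
lemma hasDerivAt_trajectory (hA : G * A₀ = A₀ * (G + 1)) (hC : G * C = C)
    (hP : X⁻¹.PosDef) (hG : (X⁻¹ * G + Gᵀ * X⁻¹).PosDef)
    (hH : X⁻¹ * (A₀ + C + G) + (A₀ + C + G)ᵀ * X⁻¹ = 0) (hz : qform X⁻¹ z = 1)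
    (hT : 0 < T) (hν : 0 < ν) (ht : t < a) :
    HasDerivAt (trajectory G (A₀ + C + G) T ν z a)
      (homField X G A₀ C T ν (trajectory G (A₀ + C + G) T ν z a t)) t := by
  rw [homField_trajectory hP hG hH hz hT hν ht]
  set H := A₀ + C + G with hHdef
  have hr : 0 < a - t := sub_pos.mpr ht
  have h1 : HasDerivAt (fun t => Real.log (a - t)) (-(a - t)⁻¹) t :=
    (((hasDerivAt_id t).const_sub a).log hr.ne').congr_deriv
      (by rw [id, neg_div, one_div])
  have h2 : HasDerivAt (fun t => -Real.log ((a - t) / T)) ((a - t)⁻¹) t := by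
    have h := ((((hasDerivAt_id t).const_sub a).div_const T).log (div_pos hr hT).ne').neg
    refine h.congr_deriv ?_
    simp only [id]
    field_simp
  have h3 := (hasDerivAt_dil G (Real.log (a - t))).scomp t h1
  have h4 := (hasDerivAt_dil H (-Real.log ((a - t) / T))).scomp t h2
  have h5 := ((mulVecCLM z).hasFDerivAt.comp_hasDerivAt t (h3.mul h4)).const_smul ν
  refine (h5.congr_of_eventuallyEq (Eventually.of_forall fun t => ?_)).congr_deriv ?_
  · change _ = ν • ((dil G (Real.log (a - t)) * dil H (-Real.log ((a - t) / T))) *ᵥ z)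
    rw [← mulVec_mulVec]
    rfl
  change ν • (((-(a - t)⁻¹ • (G * dil G (Real.log (a - t)))) * dil H (-Real.log ((a - t) / T)) +
    dil G (Real.log (a - t)) * ((a - t)⁻¹ • (H * dil H (-Real.log ((a - t) / T))))) *ᵥ z) = _
  have hcomm : G * dil G (Real.log (a - t)) = dil G (Real.log (a - t)) * G :=
    (((Commute.refl G).smul_right _).exp_right).eq
  have hkey : dil G (Real.log (a - t)) * (A₀ + C) =
      (a - t) • (A₀ * dil G (Real.log (a - t)) + C) := by
    rw [mul_add, dil_mul_eq_exp_smul hA, dil_mul_eq_exp_smul_of_fixed hC, Real.exp_log hr,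
      ← smul_add]
  have hmat : (-(a - t)⁻¹ • (G * dil G (Real.log (a - t)))) * dil H (-Real.log ((a - t) / T)) +
      dil G (Real.log (a - t)) * ((a - t)⁻¹ • (H * dil H (-Real.log ((a - t) / T)))) =
      (A₀ * dil G (Real.log (a - t)) + C) * dil H (-Real.log ((a - t) / T)) := by
    have : (A₀ * dil G (Real.log (a - t)) + C) =
        (a - t)⁻¹ • (dil G (Real.log (a - t)) * (A₀ + C)) := by
      rw [hkey, smul_smul, inv_mul_cancel₀ hr.ne', one_smul]
    rw [this, hcomm, hHdef]
    simp only [Matrix.mul_smul, Matrix.smul_mul, mul_add, add_mul, Matrix.mul_assoc]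
    module
  rw [hmat, add_mul, add_mulVec, smul_add, trajectory, mulVec_smul, ← mulVec_mulVec,
    ← mulVec_mulVec, ← mulVec_mulVec]

lemma weightedNorm_trajectory_le (hP : X⁻¹.PosDef) (hG : (X⁻¹ * G + Gᵀ * X⁻¹).PosDef)
    {H : Matrix (Fin n) (Fin n) ℝ} (hH : X⁻¹ * H + Hᵀ * X⁻¹ = 0) (hz : qform X⁻¹ z = 1)
    (hT : 0 < T) (hν : 0 < ν) (ht : t < a) (hat : a - t ≤ T) :
    weightedNorm X G T (trajectory G H T ν z a t) ≤ ν := by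
  obtain ⟨α, hα, h⟩ := exists_exp_mul_qform_dil_le hP hG
  set w := dil H (-Real.log ((a - t) / T)) *ᵥ z with hw
  have hqw : qform X⁻¹ w = 1 := by rw [hw, qform_dil_of_skew hH, hz]
  have hlog : Real.log ((a - t) / T) ≤ 0 :=
    Real.log_nonpos (div_pos (sub_pos.mpr ht) hT).le ((div_le_one hT).mpr hat)
  have h1 := h w _ 0 hlog
  rw [dil_zero, one_mulVec, hqw] at h1
  have h2 : qform X⁻¹ (dil G (Real.log ((a - t) / T)) *ᵥ w) ≤ 1 := by
    refine le_trans (le_mul_of_one_le_left (qform_nonneg hP _) ?_) h1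
    exact Real.one_le_exp (mul_nonneg hα.le (by linarith))
  rw [weightedNorm_eq, dil_trajectory hT ht, ← hw, qform_smul]
  refine Real.sqrt_le_iff.mpr ⟨hν.le, ?_⟩
  exact mul_le_of_le_one_right (sq_nonneg ν) h2

lemma tendsto_trajectory (hP : X⁻¹.PosDef) (hG : (X⁻¹ * G + Gᵀ * X⁻¹).PosDef)
    {H : Matrix (Fin n) (Fin n) ℝ} (hH : X⁻¹ * H + Hᵀ * X⁻¹ = 0) (hz : qform X⁻¹ z = 1) :
    Tendsto (trajectory G H T ν z a) (𝓝[<] a) (𝓝 0) := by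
  obtain ⟨α, hα, h⟩ := exists_exp_mul_qform_dil_le hP hG
  obtain ⟨β, hβ, hβ'⟩ := exists_mul_norm_sq_le_qform hP
  have hlog : Tendsto (fun t => Real.log (a - t)) (𝓝[<] a) atBot := by
    refine Real.tendsto_log_nhdsGT_zero.comp (tendsto_nhdsWithin_iff.mpr ⟨?_, ?_⟩)
    · have : Continuous fun t : ℝ => a - t := by fun_prop
      simpa using (this.tendsto a).mono_left nhdsWithin_le_nhds
    · exact eventually_mem_nhdsWithin.mono fun t ht => Set.mem_Ioi.mpr (sub_pos.mpr ht)
  have hexp : Tendsto (fun t => √(Real.exp (α * Real.log (a - t)) / β)) (𝓝[<] a) (𝓝 0) := by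
    have h1 : Tendsto (fun t => Real.exp (α * Real.log (a - t)) / β) (𝓝[<] a) (𝓝 0) := by
      simpa using (Real.tendsto_exp_atBot.comp (hlog.const_mul_atBot hα)).div_const β
    simpa [Function.comp_def] using (Real.continuous_sqrt.tendsto 0).comp h1
  have hmain : Tendsto (fun t => dil G (Real.log (a - t)) *ᵥ
      (dil H (-Real.log ((a - t) / T)) *ᵥ z)) (𝓝[<] a) (𝓝 0) := by
    refine squeeze_zero_norm' ?_ hexp
    filter_upwards [hlog.eventually (eventually_le_atBot 0)] with t ht
    set w := dil H (-Real.log ((a - t) / T)) *ᵥ z with hw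
    have hqw : qform X⁻¹ w = 1 := by rw [hw, qform_dil_of_skew hH, hz]
    have h1 := h w _ 0 ht
    rw [dil_zero, one_mulVec, hqw, zero_sub, mul_neg, Real.exp_neg] at h1
    rw [inv_mul_le_iff₀ (Real.exp_pos _), mul_one] at h1
    refine Real.le_sqrt_of_sq_le ((le_div_iff₀' hβ).mpr ((hβ' _).trans h1))
  have h := hmain.const_smul ν
  rwa [smul_zero] at h

lemma exists_norm_homField_trajectory_le (hP : X⁻¹.PosDef) (hG : (X⁻¹ * G + Gᵀ * X⁻¹).PosDef)
    {H : Matrix (Fin n) (Fin n) ℝ} (hH : X⁻¹ * H + Hᵀ * X⁻¹ = 0) (hz : qform X⁻¹ z = 1)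
    (hT : 0 < T) (hν : 0 < ν) :
    ∃ M, ∀ t, t < a → a - t ≤ T → ‖homField X G A₀ C T ν (trajectory G H T ν z a t)‖ ≤ M := by
  obtain ⟨β, hβ, hβ'⟩ := exists_mul_norm_sq_le_qform hP
  have hbd : ∀ (v : Fin n → ℝ) (c : ℝ), qform X⁻¹ v ≤ c → ‖v‖ ≤ √(c / β) := fun v c hv =>
    Real.le_sqrt_of_sq_le ((le_div_iff₀' hβ).mpr ((hβ' v).trans hv))
  let L₁ := LinearMap.toContinuousLinearMap (A₀ * dil G (Real.log T)).mulVecLin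
  let L₂ := LinearMap.toContinuousLinearMap C.mulVecLin
  refine ⟨‖L₁‖ * √(ν ^ 2 / β) + ν * (‖L₂‖ * √(1 / β)), fun t ht hat => ?_⟩
  rw [homField_trajectory hP hG hH hz hT hν ht]
  refine (norm_add_le _ _).trans (add_le_add ?_ ?_)
  · have h1 : A₀ *ᵥ trajectory G H T ν z a t =
        L₁ (dil G (-Real.log T) *ᵥ trajectory G H T ν z a t) := by
      change _ = (A₀ * dil G (Real.log T)) *ᵥ _
      rw [← mulVec_mulVec, dil_mulVec_dil_mulVec, add_neg_cancel, dil_zero, one_mulVec]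
    rw [h1]
    refine (L₁.le_opNorm _).trans (mul_le_mul_of_nonneg_left (hbd _ _ ?_) (norm_nonneg _))
    have h2 := weightedNorm_trajectory_le hP hG hH hz hT hν ht hat
    rw [weightedNorm_eq, Real.sqrt_le_left hν.le] at h2
    exact h2
  · rw [norm_smul, Real.norm_of_nonneg hν.le]
    refine mul_le_mul_of_nonneg_left ((L₂.le_opNorm _).trans
      (mul_le_mul_of_nonneg_left (hbd _ _ ?_) (norm_nonneg _))) hν.le
    rw [qform_dil_of_skew hH, hz]

/-- Every nonzero state lies on a trajectory; if its weighted norm is `ν`, then the origin is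
reached after the time `T`. -/
lemma exists_trajectory_eq (hP : X⁻¹.PosDef) (hG : (X⁻¹ * G + Gᵀ * X⁻¹).PosDef)
    {H : Matrix (Fin n) (Fin n) ℝ} (hH : X⁻¹ * H + Hᵀ * X⁻¹ = 0) (hT : 0 < T) (hν : 0 < ν)
    {x : Fin n → ℝ} (hx : x ≠ 0) (t : ℝ) :
    ∃ a z, t < a ∧ qform X⁻¹ z = 1 ∧ trajectory G H T ν z a t = x ∧
      (weightedNorm X G T x = ν → a = t + T) := by
  have hy : ν⁻¹ • x ≠ 0 := smul_ne_zero (inv_ne_zero hν.ne') hx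
  obtain ⟨s, hs, huniq⟩ := existsUnique_weightedNorm_eq_one hP hG T hy
  have ha : t + T * Real.exp s - t = T * Real.exp s := by ring
  have hr : (t + T * Real.exp s - t) / T = Real.exp s := by
    rw [ha, mul_div_cancel_left₀ _ hT.ne']
  refine ⟨t + T * Real.exp s,
    dil H s *ᵥ (dil G (-Real.log T) *ᵥ (dil G (-s) *ᵥ (ν⁻¹ • x))), ?_, ?_, ?_, ?_⟩
  · exact lt_add_of_pos_right _ (mul_pos hT (Real.exp_pos s))
  · rw [qform_dil_of_skew hH]
    rwa [weightedNorm_eq, Real.sqrt_eq_one] at hs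
  · rw [trajectory, hr, Real.log_exp, dil_mulVec_dil_mulVec H, neg_add_cancel, dil_zero,
      one_mulVec, ha, Real.log_mul hT.ne' (Real.exp_pos s).ne', Real.log_exp,
      dil_mulVec_dil_mulVec, dil_mulVec_dil_mulVec,
      show Real.log T + s + -Real.log T + -s = 0 by ring, dil_zero, one_mulVec, smul_smul,
      mul_inv_cancel₀ hν.ne', one_smul]
  · intro hxν
    have h0 : s = 0 := by
      refine (huniq 0 ?_).symm
      simp only [neg_zero, dil_zero, one_mulVec]
      rw [weightedNorm_smul, hxν, abs_of_pos (inv_pos.mpr hν), inv_mul_cancel₀ hν.ne']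
    rw [h0, Real.exp_zero, mul_one]

end Trajectories

/-! ### Filippov solutions -/

section Filippov

open Filter Topology MeasureTheory Set

variable {n : ℕ} {g : (Fin n → ℝ) → (Fin n → ℝ)}

lemma eq_of_mem_filippovMap {x v : Fin n → ℝ} (hg : ContinuousAt g x) (hv : v ∈ filippovMap g x) :
    v = g x := by
  refine eq_of_forall_dist_le fun ε hε => ?_
  obtain ⟨δ, hδ, h⟩ := Metric.continuousAt_iff.mp hg ε hε
  have h1 : closure (convexHull ℝ (g '' (Metric.ball x δ \ ∅))) ⊆ Metric.closedBall (g x) ε := by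
    refine closure_minimal (convexHull_min ?_ (convex_closedBall _ _)) Metric.isClosed_closedBall
    rintro _ ⟨y, hy, rfl⟩
    exact (h hy.1).le
  exact h1 (hv δ hδ ∅ measure_empty)

lemma exists_mem_ball_notMem (x : Fin n → ℝ) {δ : ℝ} (hδ : 0 < δ) {S : Set (Fin n → ℝ)}
    (hS : volume S = 0) : ∃ y ∈ Metric.ball x δ, y ∉ S := by
  by_contra! h
  exact (Metric.measure_ball_pos volume x hδ).ne' (measure_mono_null h hS)

lemma mem_filippovMap {x : Fin n → ℝ} (hg : ContinuousAt g x) : g x ∈ filippovMap g x := by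
  intro δ hδ S hS
  refine closure_mono (subset_convexHull ℝ _) (Metric.mem_closure_iff.mpr fun ε hε => ?_)
  obtain ⟨δ', hδ', h⟩ := Metric.continuousAt_iff.mp hg ε hε
  obtain ⟨y, hy, hyS⟩ := exists_mem_ball_notMem x (lt_min hδ hδ') hS
  exact ⟨g y, ⟨y, ⟨Metric.ball_subset_ball (min_le_left _ _) hy, hyS⟩, rfl⟩,
    by rw [dist_comm]; exact h (Metric.ball_subset_ball (min_le_right _ _) hy)⟩

lemma zero_mem_filippovMap (hodd : ∀ y, g (-y) = -g y) : 0 ∈ filippovMap g 0 := by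
  intro δ hδ S hS
  have hS' : volume (S ∪ -S) = 0 :=
    measure_union_null hS (by rw [Measure.measure_neg]; exact hS)
  obtain ⟨y, hy, hyS⟩ := exists_mem_ball_notMem 0 hδ hS'
  rw [mem_union, not_or] at hyS
  have h1 : g y ∈ convexHull ℝ (g '' (Metric.ball 0 δ \ S)) :=
    subset_convexHull ℝ _ ⟨y, ⟨hy, hyS.1⟩, rfl⟩
  have h2 : -g y ∈ convexHull ℝ (g '' (Metric.ball 0 δ \ S)) :=
    subset_convexHull ℝ _ ⟨-y, ⟨by simpa using hy, by simpa using hyS.2⟩, hodd y⟩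
  refine subset_closure ?_
  have h3 := convex_convexHull ℝ (g '' (Metric.ball 0 δ \ S)) h1 h2
    (by norm_num : (0 : ℝ) ≤ 1 / 2) (by norm_num : (0 : ℝ) ≤ 1 / 2) (by norm_num)
  simpa using h3

/-- A Filippov solution is a classical solution as long as it stays in an open set on which
the vector field is continuous. -/
lemma IsFilippovSolutionOn.hasDerivWithinAt {f : (Fin n → ℝ) → (Fin n → ℝ) → (Fin n → ℝ)}
    {x₀ : Fin n → ℝ} {b : ℝ} {x : ℝ → (Fin n → ℝ)} (h : IsFilippovSolutionOn f x₀ b x)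
    (hb : 0 < b) {U : Set (Fin n → ℝ)} (hU : IsOpen U)
    (hg : ∀ y ∈ U, ContinuousAt (fun y => f y x₀) y) {t : ℝ} (ht : t ∈ Icc 0 b) (hxt : x t ∈ U) :
    HasDerivWithinAt x (f (x t) x₀) (Icc 0 b) t := by
  obtain ⟨-, hac, hder⟩ := h
  have hcont : ContinuousOn x (Icc 0 b) := by
    have := hac.continuousOn
    rwa [uIcc_of_le hb.le] at this
  obtain ⟨ε, hε, hεU⟩ := Metric.mem_nhdsWithin_iff.mp (hcont t ht (hU.mem_nhds hxt))
  set c := max 0 (t - ε / 2) with hc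
  set d := min b (t + ε / 2) with hd
  have hct : c ≤ t := max_le ht.1 (by linarith)
  have htd : t ≤ d := le_min ht.2 (by linarith)
  have hcd : c ≤ d := hct.trans htd
  have h0c : 0 ≤ c := le_max_left _ _
  have hdb : d ≤ b := min_le_left _ _
  have hsub : Icc c d ⊆ Icc 0 b := Icc_subset_Icc h0c hdb
  have hxU : ∀ s ∈ Icc c d, x s ∈ U := by
    intro s hs
    refine hεU ⟨?_, hsub hs⟩
    have h1 := (le_max_right 0 (t - ε / 2)).trans hs.1
    have h2 := hs.2.trans (min_le_right b (t + ε / 2))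
    rw [Metric.mem_ball, Real.dist_eq, abs_lt]
    constructor <;> linarith
  have hnhds : Icc c d ∈ 𝓝[Icc 0 b] t := by
    refine Metric.mem_nhdsWithin_iff.mpr ⟨ε / 2, by linarith, fun s hs => ?_⟩
    have h1 := hs.1
    rw [Metric.mem_ball, Real.dist_eq, abs_lt] at h1
    exact ⟨max_le hs.2.1 (by linarith), le_min hs.2.2 (by linarith)⟩
  -- compare `x` with the integral of the continuous function `f (x ·) x₀`
  have hgx : ContinuousOn (fun s => f (x s) x₀) (Icc c d) := fun s hs =>
    (hg _ (hxU s hs)).comp_continuousWithinAt (hcont.mono hsub s hs)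
  set k : ℝ → (Fin n → ℝ) := IccExtend hcd ((Icc c d).domRestrict fun s => f (x s) x₀) with hk
  have hkc : Continuous k := (continuousOn_iff_continuous_domRestrict.mp hgx).Icc_extend'
  have hkx : ∀ s ∈ Icc c d, k s = f (x s) x₀ := fun s hs => by
    rw [hk, IccExtend_of_mem _ _ hs, domRestrict_apply]
  set J : ℝ → (Fin n → ℝ) := fun u => ∫ s in c..u, k s with hJ
  have hJder : ∀ s, HasDerivAt J (k s) s := fun s => hkc.integral_hasStrictDerivAt c s |>.hasDerivAt
  have hJac : AbsolutelyContinuousOnInterval J c d := by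
    refine ContDiffOn.absolutelyContinuousOnInterval (ContDiff.contDiffOn ?_)
    rw [contDiff_one_iff_deriv]
    refine ⟨fun s => (hJder s).differentiableAt, ?_⟩
    rwa [show deriv J = k from funext fun s => (hJder s).deriv]
  have hxac : AbsolutelyContinuousOnInterval x c d := by
    refine hac.mono ?_
    rwa [uIcc_of_le hcd, uIcc_of_le hb.le]
  obtain ⟨K, hK⟩ := (hxac.sub hJac).const_of_ae_hasDerivAt_zero (by
    have hne : ∀ r : ℝ, ∀ᵐ s : ℝ, s ≠ r := fun r => by simp [ae_iff]
    filter_upwards [hder, hne c, hne d] with s hs hsc hsd hsI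
    rw [uIcc_of_le hcd] at hsI
    obtain ⟨v, hv, hxv⟩ := hs ⟨h0c.trans_lt (lt_of_le_of_ne hsI.1 hsc.symm),
      (lt_of_le_of_ne hsI.2 hsd).trans_le hdb⟩
    have hvg := eq_of_mem_filippovMap (hg _ (hxU s hsI)) hv
    have h1 := hxv.sub (hJder s)
    rwa [hvg, hkx s hsI, sub_self] at h1)
  have hxJ : ∀ s ∈ Icc c d, x s = J s + K := fun s hs => by
    rw [uIcc_of_le hcd] at hK
    rw [← hK s hs, Pi.sub_apply]; abel
  have h2 : HasDerivWithinAt x (k t) (Icc c d) t :=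
    ((hJder t).add_const K).hasDerivWithinAt.congr hxJ (hxJ t ⟨hct, htd⟩)
  rw [hkx t ⟨hct, htd⟩] at h2
  exact h2.mono_of_mem_nhdsWithin hnhds

/-- Forward uniqueness for a vector field that is locally Lipschitz on a set in which one of the
two curves stays. -/
lemma eqOn_Icc_of_locallyLipschitz {U : Set (Fin n → ℝ)} (hU : IsOpen U)
    (hg : ∀ y ∈ U, ∃ K, ∃ s ∈ 𝓝 y, LipschitzOnWith K g s) {x y : ℝ → (Fin n → ℝ)} {c d : ℝ}
    (hx : ContinuousOn x (Icc c d))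
    (hx' : ∀ t ∈ Ico c d, x t ∈ U → HasDerivWithinAt x (g (x t)) (Ici t) t)
    (hy : ContinuousOn y (Icc c d))
    (hy' : ∀ t ∈ Ico c d, HasDerivWithinAt y (g (y t)) (Ici t) t)
    (hyU : ∀ t ∈ Ico c d, y t ∈ U) (hc : x c = y c) : EqOn x y (Icc c d) := by
  refine IsClosed.Icc_subset_of_forall_mem_nhdsWithin (s := {t | x t = y t}) ?_ hc ?_
  · have := (hx.sub hy).preimage_isClosed_of_isClosed isClosed_Icc
      (isClosed_singleton (x := (0 : Fin n → ℝ)))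
    convert! this using 1
    ext t
    simp [sub_eq_zero, and_comm]
  · rintro t ⟨htxy, htI⟩
    obtain ⟨K, s, hs, hK⟩ := hg _ (hyU t htI)
    have hmem : ∀ {z : ℝ → (Fin n → ℝ)}, ContinuousOn z (Icc c d) → z t = y t →
        ∀ᶠ r in 𝓝[≥] t, z r ∈ s ∩ U := by
      intro z hz hzt
      have h1 : Tendsto z (𝓝[Icc t d] t) (𝓝 (z t)) :=
        (hz t ⟨htI.1, htI.2.le⟩).mono (Icc_subset_Icc_left htI.1)
      rw [nhdsWithin_Icc_eq_nhdsGE htI.2] at h1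
      exact h1.eventually (hzt ▸ inter_mem hs (hU.mem_nhds (hyU t htI)))
    obtain ⟨e, he, heS⟩ := (mem_nhdsGE_iff_exists_Icc_subset.mp
      ((hmem hx htxy).and (hmem hy rfl)))
    set d' := min e d with hd'
    have htd' : t < d' := lt_min he htI.2
    have hsub : Icc t d' ⊆ Icc c d := Icc_subset_Icc htI.1 (min_le_right _ _)
    have hIco : ∀ r ∈ Ico t d', r ∈ Ico c d := fun r hr =>
      ⟨htI.1.trans hr.1, hr.2.trans_le (min_le_right _ _)⟩
    have hIcc : ∀ r ∈ Ico t d', r ∈ Icc t e := fun r hr =>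
      ⟨hr.1, hr.2.le.trans (min_le_left _ _)⟩
    have huniq := ODE_solution_unique_of_mem_Icc_right (v := fun _ => g) (s := fun _ => s)
      (fun _ _ => hK) (hx.mono hsub)
      (fun r hr => hx' r (hIco r hr) (heS (hIcc r hr)).1.2)
      (fun r hr => (heS (hIcc r hr)).1.1) (hy.mono hsub) (fun r hr => hy' r (hIco r hr))
      (fun r hr => (heS (hIcc r hr)).2.1) htxy
    exact mem_of_superset (Icc_mem_nhdsGT htd') huniq

/-- The time-reversed version of `eqOn_Icc_of_locallyLipschitz`. -/
lemma eqOn_Icc_of_locallyLipschitz_left {U : Set (Fin n → ℝ)} (hU : IsOpen U)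
    (hg : ∀ y ∈ U, ∃ K, ∃ s ∈ 𝓝 y, LipschitzOnWith K g s) {x y : ℝ → (Fin n → ℝ)} {c d : ℝ}
    (hx : ContinuousOn x (Icc c d))
    (hx' : ∀ t ∈ Ioc c d, x t ∈ U → HasDerivWithinAt x (g (x t)) (Iic t) t)
    (hy : ContinuousOn y (Icc c d))
    (hy' : ∀ t ∈ Ioc c d, HasDerivWithinAt y (g (y t)) (Iic t) t)
    (hyU : ∀ t ∈ Ioc c d, y t ∈ U) (hd : x d = y d) : EqOn x y (Icc c d) := by
  have hmaps : ∀ t ∈ Icc (-d) (-c), -t ∈ Icc c d := fun t ht =>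
    ⟨by linarith [ht.2], by linarith [ht.1]⟩
  have hmaps' : ∀ t ∈ Ico (-d) (-c), -t ∈ Ioc c d := fun t ht =>
    ⟨by linarith [ht.2], by linarith [ht.1]⟩
  have hderiv : ∀ {z : ℝ → (Fin n → ℝ)} {v : Fin n → ℝ} {t : ℝ},
      HasDerivWithinAt z v (Iic (-t)) (-t) →
      HasDerivWithinAt (fun s => z (-s)) (-v) (Ici t) t := by
    intro z v t hz
    have h := hz.scomp t (hasDerivAt_neg t).hasDerivWithinAt (s := Ici t)
      (fun s hs => mem_Iic.mpr (neg_le_neg (mem_Ici.mp hs)))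
    simpa [Function.comp_def] using h
  have hrev := eqOn_Icc_of_locallyLipschitz (g := fun y => -g y) hU
    (fun z hz => by
      obtain ⟨K, s, hs, hK⟩ := hg z hz
      exact ⟨K, s, hs, fun a ha b hb => by simpa [edist_neg_neg] using hK ha hb⟩)
    (x := fun s => x (-s)) (y := fun s => y (-s)) (c := -d) (d := -c)
    (hx.comp continuousOn_neg hmaps)
    (fun t ht htU => hderiv (hx' _ (hmaps' t ht) htU))
    (hy.comp continuousOn_neg hmaps)
    (fun t ht => hderiv (hy' _ (hmaps' t ht)))
    (fun t ht => hyU _ (hmaps' t ht)) (by simpa using hd)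
  intro t ht
  have := hrev (x := -t) ⟨neg_le_neg ht.2, neg_le_neg ht.1⟩
  simpa using this

end Filippov

/-! ### Solutions of the closed loop -/

section ClosedLoop

open Filter Topology MeasureTheory Set Matrix

variable {n : ℕ} {X G A₀ C : Matrix (Fin n) (Fin n) ℝ} {T : ℝ}
  {f : (Fin n → ℝ) → (Fin n → ℝ) → (Fin n → ℝ)}

lemma closedLoop_feedback_zero {m : ℕ} (N : (Fin n → ℝ) → ℝ) (A G : Matrix (Fin n) (Fin n) ℝ)
    (B : Matrix (Fin n) (Fin m) ℝ) (K₀ K : Matrix (Fin m) (Fin n) ℝ) (T : ℝ) (y : Fin n → ℝ) :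
    closedLoop A B (feedback N G K₀ K T) y 0 = (A + B * K₀) *ᵥ y := by
  simp only [closedLoop, feedback, if_true, add_mulVec, mulVec_mulVec]

lemma closedLoop_feedback_of_ne {m : ℕ} (A : Matrix (Fin n) (Fin n) ℝ)
    (B : Matrix (Fin n) (Fin m) ℝ) (K₀ K : Matrix (Fin m) (Fin n) ℝ) (T : ℝ)
    {x₀ : Fin n → ℝ} (hx₀ : x₀ ≠ 0) :
    (fun y => closedLoop A B (feedback (weightedNorm X G T) G K₀ K T) y x₀) =
      homField X G (A + B * K₀) (B * K) T (weightedNorm X G T x₀) := by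
  funext y
  simp only [closedLoop, feedback, if_neg hx₀, homField, add_mulVec, mulVec_add, mulVec_mulVec,
    Matrix.mul_assoc, add_assoc]

lemma IsFilippovSolutionOn.eq_zero_of_linear {M : Matrix (Fin n) (Fin n) ℝ}
    (hf : ∀ y, f y 0 = M *ᵥ y) {b : ℝ} (hb : 0 < b) {x : ℝ → (Fin n → ℝ)}
    (hx : IsFilippovSolutionOn f 0 b x) : ∀ t ∈ Icc 0 b, x t = 0 := by
  have hf' : (fun y => f y 0) = fun y => M *ᵥ y := funext hf
  have hder := fun t ht => hx.hasDerivWithinAt hb isOpen_univ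
    (fun y _ => by rw [hf']; exact (contDiff_const_mulVec M).continuous.continuousAt) (t := t) ht
    (mem_univ _)
  refine eqOn_Icc_of_locallyLipschitz (g := fun y => M *ᵥ y) isOpen_univ
    (fun y _ => (contDiff_const_mulVec M).contDiffAt.exists_lipschitzOnWith)
    (fun t ht => (hder t ht).continuousWithinAt) (fun t ht _ => ?_) continuousOn_const
    (fun t _ => ?_) (fun _ _ => mem_univ _) hx.1
  · have h := hder t ⟨ht.1, ht.2.le⟩
    rw [hf] at h
    exact h.mono_of_mem_nhdsWithin (mem_of_superset (Icc_mem_nhdsGE ht.2)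
      (Icc_subset_Icc_left ht.1))
  · rw [mulVec_zero]
    exact hasDerivWithinAt_const _ _ _

/-- A Filippov solution follows the trajectory through its initial state until that one
reaches the origin, and stays at the origin afterwards: a trajectory through a later nonzero state
would have been nonzero at all earlier times. -/
lemma IsFilippovSolutionOn.eq_trajectory (hA : G * A₀ = A₀ * (G + 1)) (hC : G * C = C)
    (hP : X⁻¹.PosDef) (hG : (X⁻¹ * G + Gᵀ * X⁻¹).PosDef)
    (hH : X⁻¹ * (A₀ + C + G) + (A₀ + C + G)ᵀ * X⁻¹ = 0) (hT : 0 < T) {ν : ℝ} (hν : 0 < ν)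
    {x₀ z : Fin n → ℝ} (hf : (fun y => f y x₀) = homField X G A₀ C T ν) (hz : qform X⁻¹ z = 1)
    {a : ℝ} (ha : 0 < a) (hx₀ : trajectory G (A₀ + C + G) T ν z a 0 = x₀) {b : ℝ} (hb : 0 < b)
    {x : ℝ → (Fin n → ℝ)} (hx : IsFilippovSolutionOn f x₀ b x) :
    ∀ t ∈ Icc 0 b, x t = if t < a then trajectory G (A₀ + C + G) T ν z a t else 0 := by
  set H := A₀ + C + G with hHdef
  set g := homField X G A₀ C T ν with hg
  have hgne : ∀ y ∈ {y : Fin n → ℝ | y ≠ 0}, ContDiffAt ℝ 1 g y := fun y hy =>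
    contDiffAt_homField hP hG hν hy
  have hLip : ∀ y ∈ {y : Fin n → ℝ | y ≠ 0}, ∃ K, ∃ s ∈ 𝓝 y, LipschitzOnWith K g s :=
    fun y hy => (hgne y hy).exists_lipschitzOnWith
  have hcont : ContinuousOn x (Icc 0 b) := by
    have := hx.2.1.continuousOn
    rwa [uIcc_of_le hb.le] at this
  have hder : ∀ t ∈ Icc 0 b, x t ≠ 0 → HasDerivWithinAt x (g (x t)) (Icc 0 b) t := by
    intro t ht hxt
    have h := hx.hasDerivWithinAt hb isOpen_ne
      (fun y hy => by rw [hf]; exact (hgne y hy).continuousAt) ht hxt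
    rwa [show f (x t) x₀ = g (x t) from congrFun hf (x t)] at h
  have htraj : ∀ {w : Fin n → ℝ} {c t : ℝ}, qform X⁻¹ w = 1 → t < c →
      HasDerivAt (trajectory G H T ν w c) (g (trajectory G H T ν w c t)) t := fun hw ht =>
    hasDerivAt_trajectory hA hC hP hG hH hw hT hν ht
  have hbefore : ∀ t ∈ Icc 0 b, t < a → x t = trajectory G H T ν z a t := by
    intro t ht hta
    have hsub : Icc 0 t ⊆ Icc 0 b := Icc_subset_Icc_right ht.2
    refine eqOn_Icc_of_locallyLipschitz (g := g) isOpen_ne hLip (hcont.mono hsub)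
      (fun r hr hxr => (hder r ⟨hr.1, hr.2.le.trans ht.2⟩ hxr).mono_of_mem_nhdsWithin
        (mem_of_superset (Icc_mem_nhdsGE (hr.2.trans_le ht.2)) (Icc_subset_Icc_left hr.1)))
      (fun r hr => (htraj hz (hr.2.trans_lt hta)).continuousAt.continuousWithinAt)
      (fun r hr => (htraj hz (hr.2.trans hta)).hasDerivWithinAt)
      (fun r _ => trajectory_ne_zero hz hν) (by rw [hx.1, hx₀]) ⟨ht.1, le_rfl⟩
  have hat : a ≤ b → x a = 0 := by
    intro hab
    have h1 : Tendsto x (𝓝[<] a) (𝓝 (x a)) := by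
      have h2 : Tendsto x (𝓝[Icc 0 a] a) (𝓝 (x a)) :=
        (hcont a ⟨ha.le, hab⟩).mono (Icc_subset_Icc_right hab)
      rw [nhdsWithin_Icc_eq_nhdsLE ha] at h2
      exact h2.mono_left (nhdsWithin_mono _ Iio_subset_Iic_self)
    refine tendsto_nhds_unique (h1.congr' ?_)
      (tendsto_trajectory (T := T) (ν := ν) (a := a) hP hG hH hz)
    filter_upwards [Ioo_mem_nhdsLT ha] with t ht
    exact hbefore t ⟨ht.1.le, ht.2.le.trans hab⟩ ht.2
  intro t ht
  split_ifs with hta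
  · exact hbefore t ht hta
  · push Not at hta
    by_contra hxt
    obtain ⟨c, w, htc, hw, hwt, -⟩ := exists_trajectory_eq hP hG hH hT hν hxt t
    have heq : EqOn x (trajectory G H T ν w c) (Icc a t) :=
      eqOn_Icc_of_locallyLipschitz_left (g := g) isOpen_ne hLip
        (hcont.mono (Icc_subset_Icc ha.le ht.2))
        (fun r hr hxr => (hder r ⟨ha.le.trans hr.1.le, hr.2.trans ht.2⟩ hxr).mono_of_mem_nhdsWithin
          (mem_of_superset (Icc_mem_nhdsLE (ha.trans hr.1)) (Icc_subset_Icc_right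
            (hr.2.trans ht.2))))
        (fun r hr => (htraj hw (hr.2.trans_lt htc)).continuousAt.continuousWithinAt)
        (fun r hr => (htraj hw (hr.2.trans_lt htc)).hasDerivWithinAt)
        (fun r _ => trajectory_ne_zero hw hν) hwt.symm
    have h0 := heq ⟨le_rfl, hta⟩
    rw [hat (hta.trans ht.2)] at h0
    exact trajectory_ne_zero hw hν h0.symm

/-- The trajectory, extended by zero, is a Filippov solution: it is Lipschitz continuous because
the vector field is bounded along it, and the zero vector belongs to the Filippov set at the origin
as the vector field is odd. -/
lemma isFilippovSolution_trajectory (hA : G * A₀ = A₀ * (G + 1)) (hC : G * C = C)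
    (hP : X⁻¹.PosDef) (hG : (X⁻¹ * G + Gᵀ * X⁻¹).PosDef)
    (hH : X⁻¹ * (A₀ + C + G) + (A₀ + C + G)ᵀ * X⁻¹ = 0) (hT : 0 < T) {ν : ℝ} (hν : 0 < ν)
    {x₀ z : Fin n → ℝ} (hf : (fun y => f y x₀) = homField X G A₀ C T ν) (hz : qform X⁻¹ z = 1)
    (hx₀ : trajectory G (A₀ + C + G) T ν z T 0 = x₀) :
    IsFilippovSolution f x₀
      fun t => if t < T then trajectory G (A₀ + C + G) T ν z T t else 0 := by
  set H := A₀ + C + G with hHdef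
  set g := homField X G A₀ C T ν with hg
  set E := trajectory G H T ν z T with hE
  set x : ℝ → (Fin n → ℝ) := fun t => if t < T then E t else 0 with hx
  have hEder : ∀ {t : ℝ}, t < T → HasDerivAt E (g (E t)) t := fun ht =>
    hasDerivAt_trajectory hA hC hP hG hH hz hT hν ht
  have hlt : ∀ {t : ℝ}, t < T → HasDerivAt x (g (E t)) t := fun {t} ht =>
    (hEder ht).congr_of_eventuallyEq ((eventually_lt_nhds ht).mono fun s hs => if_pos hs)
  have hge : ∀ {t : ℝ}, T ≤ t → x t = 0 := fun ht => if_neg ht.not_gt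
  have hright : ∀ {t : ℝ}, T ≤ t → HasDerivWithinAt x 0 (Ici t) t := fun {t} ht =>
    (hasDerivWithinAt_const t (Ici t) (0 : Fin n → ℝ)).congr
      (fun s hs => hge (ht.trans hs)) (hge ht)
  have hcont : Continuous x := by
    refine continuous_iff_continuousAt.mpr fun t => ?_
    rcases lt_trichotomy t T with ht | rfl | ht
    · exact (hlt ht).continuousAt
    · refine continuousAt_iff_continuous_left'_right'.mpr ⟨?_, ?_⟩
      · refine Tendsto.congr' (eventually_mem_nhdsWithin.mono fun s hs => (if_pos hs).symm) ?_
        rw [hge le_rfl]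
        exact tendsto_trajectory hP hG hH hz
      · exact (hright le_rfl).continuousWithinAt.mono Ioi_subset_Ici_self
    · refine (continuousAt_const (y := (0 : Fin n → ℝ))).congr ?_
      exact (eventually_gt_nhds ht).mono fun s hs => (hge hs.le).symm
  obtain ⟨M, hM⟩ := exists_norm_homField_trajectory_le (A₀ := A₀) (C := C) (a := T) hP hG hH hz
    hT hν
  have hLip : ∀ s t : ℝ, 0 ≤ s → s ≤ t → ‖x t - x s‖ ≤ max M 0 * (t - s) := by
    intro s t hs hst
    refine norm_image_sub_le_of_norm_deriv_right_le_segment hcont.continuousOn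
      (f' := fun r => if r < T then g (E r) else 0) (fun r hr => ?_) (fun r hr => ?_) t
      ⟨hst, le_rfl⟩
    · split_ifs with h
      · exact (hlt h).hasDerivWithinAt
      · exact hright (not_lt.mp h)
    · split_ifs with h
      · exact (hM r h (by linarith [hs.trans hr.1])).trans (le_max_left _ _)
      · simp
  intro b hb
  refine ⟨by simp only [hx, if_pos hT, hx₀], ?_, ?_⟩
  · refine LipschitzOnWith.absolutelyContinuousOnInterval (K := (max M 0).toNNReal)
      (LipschitzOnWith.of_dist_le_mul fun t ht s hs => ?_)
    rw [uIcc_of_le hb.le] at ht hs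
    rw [Real.coe_toNNReal _ (le_max_right _ _), dist_eq_norm, Real.dist_eq]
    rcases le_total s t with h | h
    · rw [abs_of_nonneg (sub_nonneg.mpr h)]
      exact hLip s t hs.1 h
    · rw [norm_sub_rev, abs_sub_comm, abs_of_nonneg (sub_nonneg.mpr h)]
      exact hLip t s ht.1 h
  · have hne : ∀ᵐ t : ℝ, t ≠ T := by simp [ae_iff]
    filter_upwards [hne] with t htT _
    rw [hf]
    rcases lt_or_gt_of_ne htT with h | h
    · refine ⟨g (E t), ?_, hlt h⟩
      rw [show x t = E t from if_pos h]
      exact mem_filippovMap (contDiffAt_homField hP hG hν (trajectory_ne_zero hz hν)).continuousAt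
    · refine ⟨0, ?_, ?_⟩
      · rw [hge h.le]
        exact zero_mem_filippovMap (homField_neg T ν)
      · exact (hasDerivAt_const t (0 : Fin n → ℝ)).congr_of_eventuallyEq
          ((eventually_gt_nhds h).mono fun s hs => hge hs.le)

/-- All solutions starting at a nonzero state `x₀` are equal to one curve, which is nonzero exactly
before the time `T` and along which the norm never exceeds its initial value. -/
theorem exists_unique_solution_of_ne_zero (hA : G * A₀ = A₀ * (G + 1)) (hC : G * C = C)
    (hP : X⁻¹.PosDef) (hG : (X⁻¹ * G + Gᵀ * X⁻¹).PosDef)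
    (hH : X⁻¹ * (A₀ + C + G) + (A₀ + C + G)ᵀ * X⁻¹ = 0) (hT : 0 < T)
    {x₀ : Fin n → ℝ} (hx₀ : x₀ ≠ 0)
    (hf : (fun y => f y x₀) = homField X G A₀ C T (weightedNorm X G T x₀)) :
    ∃ x : ℝ → (Fin n → ℝ), IsFilippovSolution f x₀ x ∧ (∀ t ≥ T, x t = 0) ∧
      (∀ t < T, x t ≠ 0) ∧ (∀ t ≥ 0, weightedNorm X G T (x t) ≤ weightedNorm X G T x₀) ∧
      ∀ b > 0, ∀ y, IsFilippovSolutionOn f x₀ b y → ∀ t ∈ Icc 0 b, y t = x t := by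
  have hν := weightedNorm_pos (G := G) hP T hx₀
  obtain ⟨a, z, ha, hz, hx, haT⟩ := exists_trajectory_eq hP hG hH hT hν hx₀ 0
  obtain rfl : a = T := by rw [haT rfl, zero_add]
  refine ⟨_, isFilippovSolution_trajectory hA hC hP hG hH hT hν hf hz hx,
    fun t ht => if_neg ht.not_gt, fun t ht => ?_, fun t ht => ?_,
    fun b hb y hy => hy.eq_trajectory hA hC hP hG hH hT hν hf hz hT hx hb⟩
  · rw [if_pos ht]
    exact trajectory_ne_zero hz hν
  · split_ifs with h
    · exact weightedNorm_trajectory_le hP hG hH hz hT hν h (by linarith)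
    · rw [← zero_smul ℝ (0 : Fin n → ℝ), weightedNorm_smul, abs_zero, zero_mul]
      exact hν.le

end ClosedLoop

end HomStab

theorem mainTheorem1 {n m : ℕ} (A : Matrix (Fin n) (Fin n) ℝ) (B : Matrix (Fin n) (Fin m) ℝ)
    (hAB : HomStab.IsControllablePair A B) :
    -- solvability of the generator equations
    (∃ (Y₀ : Matrix (Fin m) (Fin n) ℝ) (G₀ : Matrix (Fin n) (Fin n) ℝ),
      HomStab.SolvesGeneratorEq A B Y₀ G₀) ∧
    ∀ (Y₀ : Matrix (Fin m) (Fin n) ℝ) (G₀ : Matrix (Fin n) (Fin n) ℝ),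
      HomStab.SolvesGeneratorEq A B Y₀ G₀ →
      -- properties of the solutions
      ((∀ μ : ℝ, μ ≤ 1 / (HomStab.controllabilityIndex A B : ℝ) →
          HomStab.IsAntiHurwitz (HomStab.dilationGenerator G₀ μ)) ∧
        IsUnit (G₀ - 1) ∧
        ∀ μ : ℝ,
          HomStab.shiftedMatrix A B Y₀ G₀ * HomStab.dilationGenerator G₀ μ =
            (HomStab.dilationGenerator G₀ μ + μ • (1 : Matrix (Fin n) (Fin n) ℝ)) *
              HomStab.shiftedMatrix A B Y₀ G₀ ∧
          HomStab.dilationGenerator G₀ μ * B = B) ∧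
      -- solvability of the matrix equation and inequalities
      (∀ μ : ℝ, μ ≤ 1 / (HomStab.controllabilityIndex A B : ℝ) →
        ∃ (X : Matrix (Fin n) (Fin n) ℝ) (Y : Matrix (Fin m) (Fin n) ℝ),
          HomStab.SolvesLMI (HomStab.shiftedMatrix A B Y₀ G₀) B
            (HomStab.dilationGenerator G₀ μ) X Y) ∧
      -- the closed loop, with homogeneity degree `μ = -1`
      ∀ G : Matrix (Fin n) (Fin n) ℝ, G = HomStab.dilationGenerator G₀ (-1) →
      ∀ (X : Matrix (Fin n) (Fin n) ℝ) (Y : Matrix (Fin m) (Fin n) ℝ),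
        HomStab.SolvesLMI (HomStab.shiftedMatrix A B Y₀ G₀) B G X Y →
      ∀ T : ℝ, 0 < T →
      ∀ N : (Fin n → ℝ) → ℝ, N = HomStab.weightedNorm X G T →
      ∀ f : (Fin n → ℝ) → (Fin n → ℝ) → (Fin n → ℝ),
        f = HomStab.closedLoop A B
          (HomStab.feedback N G (HomStab.linearGain Y₀ G₀) (Y * X⁻¹) T) →
        -- the canonical homogeneous norm is well defined
        HomStab.IsMonotoneDilation N G ∧
        (∀ x : Fin n → ℝ, x ≠ 0 → ∃! s : ℝ, N (HomStab.dil G (-s) *ᵥ x) = 1) ∧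
        -- fixed-time stability with the constant settling time `T`
        HomStab.IsFixedTimeStableWithConstant N f T ∧
        (∀ (x₀ : Fin n → ℝ) (x : ℝ → (Fin n → ℝ)), HomStab.IsFilippovSolution f x₀ x →
          (∀ t ≥ T, x t = 0) ∧ (x₀ ≠ 0 → ∀ t ∈ Set.Ico 0 T, x t ≠ 0)) ∧
        -- existence of a global solution, and uniqueness of all (also local) solutions
        (∀ x₀ : Fin n → ℝ, ∃ x : ℝ → (Fin n → ℝ), HomStab.IsFilippovSolution f x₀ x) ∧
        ∀ (x₀ : Fin n → ℝ) (b : ℝ), 0 < b → ∀ x y : ℝ → (Fin n → ℝ),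
          HomStab.IsFilippovSolutionOn f x₀ b x → HomStab.IsFilippovSolutionOn f x₀ b y →
          ∀ t ∈ Set.Icc 0 b, x t = y t := by
  refine ⟨HomStab.exists_solvesGeneratorEq hAB, fun Y₀ G₀ hG₀ => ⟨⟨fun μ hμ =>
    hG₀.isAntiHurwitz hAB hμ, hG₀.isUnit_sub_one hAB, fun μ =>
    ⟨hG₀.shiftedMatrix_mul_dilationGenerator hAB μ, hG₀.dilationGenerator_mul μ⟩⟩,
    fun μ hμ => hG₀.exists_solvesLMI hAB hμ, ?_⟩⟩
  rintro G rfl X Y hXY T hT N rfl f hf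
  set G := HomStab.dilationGenerator G₀ (-1)
  obtain ⟨hP, hPG⟩ := hXY.posDef_inv
  have hskew := hXY.skew
  set A₀ := HomStab.shiftedMatrix A B Y₀ G₀ with hA₀
  set N := HomStab.weightedNorm X G T with hN
  have hA : G * A₀ = A₀ * (G + 1) := by
    rw [mul_add, hG₀.shiftedMatrix_mul_dilationGenerator hAB (-1), add_mul, mul_one,
      neg_one_smul, neg_one_mul, neg_add_cancel_right]
  have hC : G * (B * (Y * X⁻¹)) = B * (Y * X⁻¹) := by
    rw [← Matrix.mul_assoc, hG₀.dilationGenerator_mul]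
  have hne : ∀ x₀, x₀ ≠ 0 → ∃ x : ℝ → (Fin n → ℝ), HomStab.IsFilippovSolution f x₀ x ∧
      (∀ t ≥ T, x t = 0) ∧ (∀ t < T, x t ≠ 0) ∧ (∀ t ≥ 0, N (x t) ≤ N x₀) ∧
      ∀ b > 0, ∀ y, HomStab.IsFilippovSolutionOn f x₀ b y → ∀ t ∈ Set.Icc 0 b, y t = x t :=
    fun x₀ hx₀ => HomStab.exists_unique_solution_of_ne_zero hA hC hP hPG hskew hT hx₀
      (by rw [hf]; exact HomStab.closedLoop_feedback_of_ne A B _ _ T hx₀)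
  have hf0 : ∀ y, f y 0 = A₀ *ᵥ y := fun y => by
    rw [hf]; exact HomStab.closedLoop_feedback_zero N A G B _ _ T y
  have hzero : ∀ b > 0, ∀ y, HomStab.IsFilippovSolutionOn f 0 b y →
      ∀ t ∈ Set.Icc 0 b, y t = 0 := fun b hb y hy => hy.eq_zero_of_linear hf0 hb
  have hzero_sol : HomStab.IsFilippovSolution f 0 fun _ => 0 := by
    intro b hb
    refine ⟨rfl, (LipschitzWith.const 0).lipschitzOnWith.absolutelyContinuousOnInterval,
      Filter.Eventually.of_forall fun t _ => ⟨0, ?_, hasDerivAt_const t _⟩⟩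
    rw [funext hf0]
    exact HomStab.zero_mem_filippovMap fun y => Matrix.mulVec_neg y A₀
  have heq : ∀ {x₀ x y}, HomStab.IsFilippovSolution f x₀ x →
      (∀ b > 0, ∀ y, HomStab.IsFilippovSolutionOn f x₀ b y → ∀ t ∈ Set.Icc 0 b, y t = x t) →
      HomStab.IsFilippovSolution f x₀ y → ∀ t ≥ 0, y t = x t := fun _ hu hy t ht =>
    hu (t + 1) (by linarith) _ (hy _ (by linarith)) t ⟨ht, by linarith⟩
  -- the norm never exceeds its initial value, so the identity serves as the class `𝒦` bound
  refine ⟨HomStab.isMonotoneDilation_weightedNorm hP hPG T,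
    fun x hx => HomStab.existsUnique_weightedNorm_eq_one hP hPG T hx,
    ⟨⟨id, ⟨continuousOn_id, strictMonoOn_id, rfl⟩, fun x₀ x hx t ht => ?_⟩,
      fun _ => T, ⟨fun _ => hT.le, fun S _ => ⟨T, ?_⟩, fun x₀ hx₀ => ?_⟩,
      ⟨T, hT, fun _ => le_rfl⟩, fun _ _ => rfl⟩,
    fun x₀ x hx => ⟨fun t ht => ?_, fun hx₀ t ht => ?_⟩,
    fun x₀ => ?_, fun x₀ b hb x y hx hy t ht => ?_⟩
  · by_cases hx₀ : x₀ = 0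
    · subst hx₀
      rw [heq hzero_sol hzero hx t ht, id]
    · obtain ⟨w, hw, -, -, hle, hu⟩ := hne x₀ hx₀
      rw [heq hw hu hx t ht]
      exact hle t ht
  · rintro _ ⟨_, -, rfl⟩
    exact le_rfl
  · obtain ⟨w, hw, h0, hn0, -, hu⟩ := hne x₀ hx₀
    refine ⟨fun x hx t ht => ?_, w, hw, fun t ht => hn0 t ht.2⟩
    rw [heq hw hu hx t (hT.le.trans ht)]
    exact h0 t ht
  · by_cases hx₀ : x₀ = 0
    · subst hx₀
      exact heq hzero_sol hzero hx t (hT.le.trans ht)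
    · obtain ⟨w, hw, h0, -, -, hu⟩ := hne x₀ hx₀
      rw [heq hw hu hx t (hT.le.trans ht)]
      exact h0 t ht
  · obtain ⟨w, hw, -, hn0, -, hu⟩ := hne x₀ hx₀
    rw [heq hw hu hx t ht.1]
    exact hn0 t ht.2
  · by_cases hx₀ : x₀ = 0
    · subst hx₀
      exact ⟨_, hzero_sol⟩
    · obtain ⟨w, hw, -⟩ := hne x₀ hx₀
      exact ⟨w, hw⟩
  · by_cases hx₀ : x₀ = 0
    · subst hx₀
      rw [hzero b hb x hx t ht, hzero b hb y hy t ht]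
    · obtain ⟨w, -, -, -, -, hu⟩ := hne x₀ hx₀
      rw [hu b hb x hx t ht, hu b hb y hy t ht]
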